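/- Write $[n]=\{1,\dots,n\}$, $[n]_0=[n]\cup\{0\}$. A *partial set supercomposition* of bidegree $(n,m)$, $m\le n+1$, is a tuple $K=(K_1,\dots,K_q)$ of nonempty subsets (blocks) of $[n]_0$ whose union contains $[n]$, with $K_i\cap K_j\subseteq\{0\}$ for $i\ne j$, such that exactly $K_1,\dots,K_m$ contain $0$ (the *fermionic* blocks) and $K_{m+1},\dots,K_q$ are listed by increasing minima. Let $s\mathcal C_{n,m}$ be the set of these. Put $K\sqsubseteq L$ if, for each $i\in[m]$, $L_i$ is the union of $K_i$ and some nonfermionic blocks of $K$, and each nonfermionic block of $L$ is a union of nonfermionic blocks of $K$. This is a meet-semilattice order (meet $\sqcap$) with least element $\hat 0_{n,m}=(\{0\},\dots,\{0\},\{1\},\dots,\{n\})$; $\mu$ denotes its Möbius function, $(-1)^K=\prod_i(-1)^{|K_i|-1}$ and $K!=\prod_i|K_i|!$. A *set superpartition* of bidegree $(n,m)$ is an $I\in s\mathcal C_{n,m}$ with $I_i\ne I_j$ and $\min(I_i\setminus I_j)<\min(I_j\setminus I_i)$ for all $i<j$, where $\min\emptyset:=0$. Consider formal power series of bounded degree over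 $\mathbb Q$ in variables $x_1,x_2,\dots$ and $\theta_1,\theta_2,\dots$ subject to $x_i\theta_j=\theta_jx_i$ and $\theta_i\theta_j=-\theta_j\theta_i$ (the $x_i$ do not commute with each other). Let $\mathbf{sNCSym}$ be the space of those series that are invariant under all simultaneous permutations of the indices of the $x$'s and the $\theta$'s by $\mathfrak S_N$, for all $N$. For $K\in s\mathcal C_{n,m}$ let $p_K$, respectively $e_K$, be the sum of $\theta_{a_1}\cdots\theta_{a_m}x_{b_1}\cdots x_{b_n}$ over all tuples of positive integers $(a,b)$ such that * for $p_K$: $a_i=b_j$ whenever $j\in K_i\setminus\{0\}$, $i\in[m]$, and $b_i=b_j$ whenever $i,j\in[n]$ lie in the same block of $K$; * for $e_K$: $a_i\neq b_j$ whenever $j\in K_i\setminus\{0\}$, $i\in[m]$, and $b_i\ne b_j$ whenever $i\neq j$ in $[n]$ lie in the same block of $K$. Let $h_K=\sum c_{a,b}\,\theta_{a_1}\cdots\theta_{a_m}x_{b_1}\cdots x_{b_n}$, the sum being over all $(a,b)$ with $a_1,\dots,a_m$ distinct such that $\{a_1,\dots,a_m\}\setminus\{b_1,\dots,b_n\}$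 has at most one element, where $c_{a,b}=(K\sqcap L)!$ for the unique $L\in s\mathcal C_{n,m}$ such that ($a_i=b_j\iff j\in L_i$ for $i\in[m]$, $j\in[n]$) and ($b_i=b_j\iff i,j$ lie in the same block of $L$, for $i,j\in[n]$). All $p_K,e_K,h_K$ lie in $\mathbf{sNCSym}$. **Proposition.** For every set superpartition $I$ of bidegree $(n,m)$, with $K,L$ ranging over $s\mathcal C_{n,m}$, $$e_I=\sum_{K\sqsubseteq I}\mu(\hat 0_{n,m},K)\,p_K,\qquad p_I=\frac1{\mu(\hat 0_{n,m},I)}\sum_{K\sqsubseteq I}\mu(K,I)\,e_K,$$ $$h_I=\sum_{K\sqsubseteq I}|\mu(\hat 0_{n,m},K)|\,p_K,\qquad p_I=\frac1{|\mu(\hat 0_{n,m},I)|}\sum_{K\sqsubseteq I}\mu(K,I)\,h_K,$$ $$e_I=\sum_{K\sqsubseteq I}(-1)^K\sum_{L\sqsubseteq K}\mu(L,K)\,h_L,\qquad h_I=\sum_{K\sqsubseteq I}(-1)^K\sum_{L\sqsubseteq K}\mu(L,K)\,e_L.$$ Moreover there is a unique linear map $\omega:\mathbf{sNCSym}\to\mathbf{sNCSym}$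 with $\omega(e_I)=h_I$ for all set superpartitions $I$ (of all bidegrees); it satisfies $\omega^2=1$ and $\omega(p_I)=(-1)^Ip_I$ for all set superpartitions $I$. -/

import Mathlib

noncomputable section

namespace SuperNC

open Finset
open scoped Classical

/-! ## Partial set supercompositions -/

/-- A partial set supercomposition of bidegree `(n, m)`: blocks are subsets of `{0, 1, …, n}`,
realised as `Fin (n + 1)`.  `fer i` is the `i`-th fermionic block (the blocks containing `0`, which
form an ordered list of length `m`), and `bos` is the collection of the nonfermionic blocks; as these
are nonempty and disjoint, listing them by increasing minima is the same as giving the collection. -/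
@[ext]
structure PSC (n m : ℕ) where
  /-- the fermionic blocks, in order -/
  fer : Fin m → Finset (Fin (n + 1))
  /-- the collection of nonfermionic blocks -/
  bos : Finset (Finset (Fin (n + 1)))
  df_le : m ≤ n + 1
  zero_mem_fer : ∀ i, 0 ∈ fer i
  zero_notMem_bos : ∀ B ∈ bos, 0 ∉ B
  bos_nonempty : ∀ B ∈ bos, B.Nonempty
  fer_inter_fer : ∀ i j, i ≠ j → fer i ∩ fer j ⊆ {0}
  fer_disjoint_bos : ∀ i, ∀ B ∈ bos, Disjoint (fer i) B
  bos_disjoint : ∀ B ∈ bos, ∀ C ∈ bos, B ≠ C → Disjoint B C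
  cover : ∀ j, j ≠ 0 → (∃ i, j ∈ fer i) ∨ ∃ B ∈ bos, j ∈ B

namespace PSC

variable {n m : ℕ}

instance : Fintype (PSC n m) :=
  Fintype.ofInjective (fun K : PSC n m => (K.fer, K.bos)) (by
    intro K L h
    exact PSC.ext (congrArg Prod.fst h) (congrArg Prod.snd h))

/-- `j` and `k` belong to a common block of `K`. -/
def SameBlock (K : PSC n m) (j k : Fin (n + 1)) : Prop :=
  (∃ i, j ∈ K.fer i ∧ k ∈ K.fer i) ∨ ∃ B ∈ K.bos, j ∈ B ∧ k ∈ B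

lemma fer_unique (K : PSC n m) {j : Fin (n + 1)} (hj : j ≠ 0) {i i' : Fin m}
    (h : j ∈ K.fer i) (h' : j ∈ K.fer i') : i = i' := by
  by_contra hne
  exact hj (by simpa using K.fer_inter_fer i i' hne (mem_inter.2 ⟨h, h'⟩))

lemma fer_bos_false (K : PSC n m) {j : Fin (n + 1)} {i : Fin m} {B : Finset (Fin (n + 1))}
    (hB : B ∈ K.bos) (h : j ∈ K.fer i) (h' : j ∈ B) : False :=
  Finset.disjoint_left.1 (K.fer_disjoint_bos i B hB) h h'

lemma bos_unique (K : PSC n m) {j : Fin (n + 1)} {B C : Finset (Fin (n + 1))}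
    (hB : B ∈ K.bos) (hC : C ∈ K.bos) (h : j ∈ B) (h' : j ∈ C) : B = C := by
  by_contra hne
  exact Finset.disjoint_left.1 (K.bos_disjoint B hB C hC hne) h h'

lemma sameBlock_refl (K : PSC n m) {j : Fin (n + 1)} (hj : j ≠ 0) : K.SameBlock j j := by
  rcases K.cover j hj with ⟨i, hi⟩ | ⟨B, hB, h⟩
  · exact Or.inl ⟨i, hi, hi⟩
  · exact Or.inr ⟨B, hB, h, h⟩

lemma SameBlock.symm {K : PSC n m} {j k : Fin (n + 1)} (h : K.SameBlock j k) :
    K.SameBlock k j := by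
  rcases h with ⟨i, h1, h2⟩ | ⟨B, hB, h1, h2⟩
  · exact Or.inl ⟨i, h2, h1⟩
  · exact Or.inr ⟨B, hB, h2, h1⟩

lemma SameBlock.mem_fer {K : PSC n m} {j k : Fin (n + 1)} (hj : j ≠ 0) (h : K.SameBlock j k)
    {i : Fin m} (hi : j ∈ K.fer i) : k ∈ K.fer i := by
  rcases h with ⟨i', h1, h2⟩ | ⟨B, hB, h1, h2⟩
  · rwa [K.fer_unique hj hi h1]
  · exact (K.fer_bos_false hB hi h1).elim

lemma SameBlock.mem_bos {K : PSC n m} {j k : Fin (n + 1)} (h : K.SameBlock j k)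
    {B : Finset (Fin (n + 1))} (hB : B ∈ K.bos) (hj : j ∈ B) : k ∈ B := by
  rcases h with ⟨i', h1, h2⟩ | ⟨C, hC, h1, h2⟩
  · exact (K.fer_bos_false hB h1 hj).elim
  · rwa [K.bos_unique hB hC hj h1]

lemma SameBlock.trans {K : PSC n m} {j k l : Fin (n + 1)} (hk : k ≠ 0) (h : K.SameBlock j k)
    (h' : K.SameBlock k l) : K.SameBlock j l := by
  rcases h with ⟨i, h1, h2⟩ | ⟨B, hB, h1, h2⟩
  · exact Or.inl ⟨i, h1, h'.mem_fer hk h2⟩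
  · exact Or.inr ⟨B, hB, h1, h'.mem_bos hB h2⟩

/-- Strong coarsening `K ⊑ L`: the `i`-th fermionic block of `L` is the `i`-th fermionic block of
`K` joined with some nonfermionic blocks of `K`, and each nonfermionic block of `L` is a union of
nonfermionic blocks of `K`. -/
instance : LE (PSC n m) where
  le K L :=
    (∀ i, ∃ S ⊆ K.bos, L.fer i = K.fer i ∪ S.biUnion id) ∧
      ∀ C ∈ L.bos, ∃ S ⊆ K.bos, C = S.biUnion id

lemma le_def (K L : PSC n m) : K ≤ L ↔
    (∀ i, ∃ S ⊆ K.bos, L.fer i = K.fer i ∪ S.biUnion id) ∧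
      ∀ C ∈ L.bos, ∃ S ⊆ K.bos, C = S.biUnion id := Iff.rfl

lemma le_iff (K L : PSC n m) : K ≤ L ↔
    (∀ i, K.fer i ⊆ L.fer i) ∧
      ∀ j k, j ≠ 0 → k ≠ 0 → K.SameBlock j k → L.SameBlock j k := by
  constructor
  · rintro ⟨h1, h2⟩
    have hf : ∀ i, K.fer i ⊆ L.fer i := by
      intro i
      obtain ⟨S, -, h⟩ := h1 i
      rw [h]
      exact subset_union_left
    refine ⟨hf, ?_⟩
    rintro j k hj hk (⟨i, hij, hik⟩ | ⟨B, hB, hjB, hkB⟩)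
    · exact Or.inl ⟨i, hf i hij, hf i hik⟩
    · rcases L.cover j hj with ⟨i, hi⟩ | ⟨C, hC, hjC⟩
      · obtain ⟨S, hS, h⟩ := h1 i
        have hi' := hi
        rw [h, mem_union, mem_biUnion] at hi'
        rcases hi' with hi' | ⟨D, hD, hjD⟩
        · exact (K.fer_bos_false hB hi' hjB).elim
        · obtain rfl := K.bos_unique hB (hS hD) hjB hjD
          refine Or.inl ⟨i, hi, ?_⟩
          rw [h]
          exact mem_union_right _ (mem_biUnion.2 ⟨B, hD, hkB⟩)
      · obtain ⟨S, hS, h⟩ := h2 C hC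
        have hj2 := hjC
        rw [h, mem_biUnion] at hj2
        obtain ⟨D, hD, hjD⟩ := hj2
        obtain rfl := K.bos_unique hB (hS hD) hjB hjD
        refine Or.inr ⟨C, hC, hjC, ?_⟩
        rw [h]
        exact mem_biUnion.2 ⟨B, hD, hkB⟩
  · rintro ⟨hf, hs⟩
    constructor
    · intro i
      refine ⟨K.bos.filter (· ⊆ L.fer i), filter_subset _ _, ?_⟩
      ext j
      simp only [mem_union, mem_biUnion, mem_filter, id]
      constructor
      · intro hj
        by_cases h0 : j = 0
        · left
          rw [h0]
          exact K.zero_mem_fer i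
        rcases K.cover j h0 with ⟨i', hi'⟩ | ⟨B, hB, hjB⟩
        · left
          rwa [L.fer_unique h0 hj (hf i' hi')]
        · right
          refine ⟨B, ⟨hB, fun k hk => ?_⟩, hjB⟩
          have hk0 : k ≠ 0 := fun h => K.zero_notMem_bos B hB (h ▸ hk)
          exact (hs j k h0 hk0 (Or.inr ⟨B, hB, hjB, hk⟩)).mem_fer h0 hj
      · rintro (hj | ⟨B, ⟨-, hB⟩, hj⟩)
        · exact hf i hj
        · exact hB hj
    · intro C hC
      refine ⟨K.bos.filter (· ⊆ C), filter_subset _ _, ?_⟩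
      ext j
      simp only [mem_biUnion, mem_filter, id]
      constructor
      · intro hj
        have h0 : j ≠ 0 := fun h => L.zero_notMem_bos C hC (h ▸ hj)
        rcases K.cover j h0 with ⟨i', hi'⟩ | ⟨B, hB, hjB⟩
        · exact (L.fer_bos_false hC (hf i' hi') hj).elim
        · refine ⟨B, ⟨hB, fun k hk => ?_⟩, hjB⟩
          have hk0 : k ≠ 0 := fun h => K.zero_notMem_bos B hB (h ▸ hk)
          exact (hs j k h0 hk0 (Or.inr ⟨B, hB, hjB, hk⟩)).mem_bos hC hj
      · rintro ⟨B, ⟨-, hB⟩, hj⟩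
        exact hB hj

lemma bos_subset_of_sameBlock {K L : PSC n m} (hf : ∀ i, L.fer i = K.fer i)
    (hs : ∀ j k, j ≠ 0 → k ≠ 0 → (K.SameBlock j k ↔ L.SameBlock j k)) : K.bos ⊆ L.bos := by
  intro B hB
  obtain ⟨j, hj⟩ := K.bos_nonempty B hB
  have h0 : j ≠ 0 := fun h => K.zero_notMem_bos B hB (h ▸ hj)
  rcases L.cover j h0 with ⟨i, hi⟩ | ⟨C, hC, hjC⟩
  · rw [hf i] at hi
    exact (K.fer_bos_false hB hi hj).elim
  · have : B = C := by
      ext k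
      constructor
      · intro hk
        have hk0 : k ≠ 0 := fun h => K.zero_notMem_bos B hB (h ▸ hk)
        exact ((hs j k h0 hk0).1 (Or.inr ⟨B, hB, hj, hk⟩)).mem_bos hC hjC
      · intro hk
        have hk0 : k ≠ 0 := fun h => L.zero_notMem_bos C hC (h ▸ hk)
        exact ((hs j k h0 hk0).2 (Or.inr ⟨C, hC, hjC, hk⟩)).mem_bos hB hj
    rwa [this]

instance : PartialOrder (PSC n m) where
  le_refl K := (le_iff K K).2 ⟨fun _ => Subset.refl _, fun _ _ _ _ h => h⟩
  le_trans K L N h1 h2 := by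
    rw [le_iff] at h1 h2 ⊢
    exact ⟨fun i => (h1.1 i).trans (h2.1 i),
      fun j k hj hk h => h2.2 j k hj hk (h1.2 j k hj hk h)⟩
  le_antisymm K L h1 h2 := by
    rw [le_iff] at h1 h2
    have hf : ∀ i, L.fer i = K.fer i := fun i => Subset.antisymm (h2.1 i) (h1.1 i)
    have hs : ∀ j k, j ≠ 0 → k ≠ 0 → (K.SameBlock j k ↔ L.SameBlock j k) :=
      fun j k hj hk => ⟨h1.2 j k hj hk, h2.2 j k hj hk⟩
    exact PSC.ext (funext fun i => (hf i).symm)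
      (Subset.antisymm (bos_subset_of_sameBlock hf hs)
        (bos_subset_of_sameBlock (fun i => (hf i).symm) fun j k hj hk => (hs j k hj hk).symm))

instance : LocallyFiniteOrder (PSC n m) := Fintype.toLocallyFiniteOrder

/-- The elements `j ∈ [n]` outside all `K_i ∩ L_i`. -/
def freeElems (K L : PSC n m) : Finset (Fin (n + 1)) :=
  univ.filter fun j => j ≠ 0 ∧ ∀ i, ¬ (j ∈ K.fer i ∧ j ∈ L.fer i)

/-- The elements of `[n]` that lie with `j` both in a block of `K` and in a block of `L`. -/
def commonClass (K L : PSC n m) (j : Fin (n + 1)) : Finset (Fin (n + 1)) :=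
  univ.filter fun k => k ≠ 0 ∧ K.SameBlock j k ∧ L.SameBlock j k

/-- The meet `K ⊓ L`: its `i`-th fermionic block is `K_i ∩ L_i`; the other elements of `[n]` are
partitioned according to lying in a common block both for `K` and for `L`. -/
def meet (K L : PSC n m) : PSC n m where
  fer i := K.fer i ∩ L.fer i
  bos := (freeElems K L).image (commonClass K L)
  df_le := K.df_le
  zero_mem_fer i := mem_inter.2 ⟨K.zero_mem_fer i, L.zero_mem_fer i⟩
  zero_notMem_bos := by
    simp [commonClass]
  bos_nonempty := by
    intro B hB
    obtain ⟨j, hj, rfl⟩ := mem_image.1 hB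
    have h0 : j ≠ 0 := (mem_filter.1 hj).2.1
    exact ⟨j, mem_filter.2 ⟨mem_univ _, h0, K.sameBlock_refl h0, L.sameBlock_refl h0⟩⟩
  fer_inter_fer i j hij x hx := by
    simp only [mem_inter] at hx
    exact K.fer_inter_fer i j hij (mem_inter.2 ⟨hx.1.1, hx.2.1⟩)
  fer_disjoint_bos := by
    intro i B hB
    obtain ⟨j, hj, rfl⟩ := mem_image.1 hB
    rw [Finset.disjoint_left]
    intro k hk hk'
    obtain ⟨-, hk0, h1, h2⟩ := mem_filter.1 hk'
    rw [mem_inter] at hk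
    exact (mem_filter.1 hj).2.2 i ⟨h1.symm.mem_fer hk0 hk.1, h2.symm.mem_fer hk0 hk.2⟩
  bos_disjoint := by
    intro B hB C hC hne
    obtain ⟨j, hj, rfl⟩ := mem_image.1 hB
    obtain ⟨l, hl, rfl⟩ := mem_image.1 hC
    have hj0 : j ≠ 0 := (mem_filter.1 hj).2.1
    have hl0 : l ≠ 0 := (mem_filter.1 hl).2.1
    rw [Finset.disjoint_left]
    intro k hk hk'
    obtain ⟨-, hk0, h1, h2⟩ := mem_filter.1 hk
    obtain ⟨-, -, h3, h4⟩ := mem_filter.1 hk'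
    have hK : K.SameBlock j l := h1.trans hk0 h3.symm
    have hL : L.SameBlock j l := h2.trans hk0 h4.symm
    apply hne
    ext x
    simp only [commonClass, mem_filter, mem_univ, true_and]
    constructor
    · rintro ⟨hx, h5, h6⟩
      exact ⟨hx, hK.symm.trans hj0 h5, hL.symm.trans hj0 h6⟩
    · rintro ⟨hx, h5, h6⟩
      exact ⟨hx, hK.trans hl0 h5, hL.trans hl0 h6⟩
  cover := by
    intro j hj
    by_cases h : ∃ i, j ∈ K.fer i ∧ j ∈ L.fer i
    · obtain ⟨i, hi⟩ := h
      exact Or.inl ⟨i, mem_inter.2 hi⟩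
    · push Not at h
      refine Or.inr ⟨commonClass K L j, mem_image_of_mem _ (mem_filter.2 ⟨mem_univ _, hj, ?_⟩),
        mem_filter.2 ⟨mem_univ _, hj, K.sameBlock_refl hj, L.sameBlock_refl hj⟩⟩
      rintro i ⟨h1, h2⟩
      exact h i h1 h2

lemma meet_sameBlock (K L : PSC n m) {j k : Fin (n + 1)} (hj : j ≠ 0) (hk : k ≠ 0) :
    (meet K L).SameBlock j k ↔ K.SameBlock j k ∧ L.SameBlock j k := by
  constructor
  · rintro (⟨i, h1, h2⟩ | ⟨B, hB, h1, h2⟩)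
    · simp only [meet, mem_inter] at h1 h2
      exact ⟨Or.inl ⟨i, h1.1, h2.1⟩, Or.inl ⟨i, h1.2, h2.2⟩⟩
    · obtain ⟨l, hl, rfl⟩ := mem_image.1 hB
      have hl0 : l ≠ 0 := (mem_filter.1 hl).2.1
      obtain ⟨-, -, h3, h4⟩ := mem_filter.1 h1
      obtain ⟨-, -, h5, h6⟩ := mem_filter.1 h2
      exact ⟨h3.symm.trans hl0 h5, h4.symm.trans hl0 h6⟩
  · rintro ⟨h1, h2⟩
    rcases (meet K L).cover j hj with ⟨i, hi⟩ | ⟨B, hB, hjB⟩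
    · have hi' := mem_inter.1 hi
      exact Or.inl ⟨i, hi, mem_inter.2 ⟨h1.mem_fer hj hi'.1, h2.mem_fer hj hi'.2⟩⟩
    · refine Or.inr ⟨B, hB, hjB, ?_⟩
      obtain ⟨l, hl, rfl⟩ := mem_image.1 hB
      obtain ⟨-, -, h3, h4⟩ := mem_filter.1 hjB
      exact mem_filter.2 ⟨mem_univ _, hk, h3.trans hj h1, h4.trans hj h2⟩

instance : SemilatticeInf (PSC n m) where
  inf := meet
  inf_le_left K L :=
    (le_iff _ _).2 ⟨fun _ => inter_subset_left, fun _ _ hj hk h => ((meet_sameBlock K L hj hk).1 h).1⟩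
  inf_le_right K L :=
    (le_iff _ _).2 ⟨fun _ => inter_subset_right,
      fun _ _ hj hk h => ((meet_sameBlock K L hj hk).1 h).2⟩
  le_inf N K L h1 h2 := by
    rw [le_iff] at h1 h2
    exact (le_iff _ _).2 ⟨fun i => subset_inter (h1.1 i) (h2.1 i),
      fun j k hj hk h => (meet_sameBlock K L hj hk).2 ⟨h1.2 j k hj hk h, h2.2 j k hj hk h⟩⟩

/-- `0̂_{n,m} = ({0}, …, {0}, {1}, …, {n})`. -/
def zeroHat (n m : ℕ) (hm : m ≤ n + 1) : PSC n m where
  fer _ := {0}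
  bos := (univ.filter fun j : Fin (n + 1) => j ≠ 0).image fun j => {j}
  df_le := hm
  zero_mem_fer _ := mem_singleton_self 0
  zero_notMem_bos := by
    intro B hB
    obtain ⟨j, hj, rfl⟩ := mem_image.1 hB
    simpa using (mem_filter.1 hj).2.symm
  bos_nonempty := by
    intro B hB
    obtain ⟨j, hj, rfl⟩ := mem_image.1 hB
    exact singleton_nonempty j
  fer_inter_fer i j _ := inter_subset_left
  fer_disjoint_bos := by
    intro i B hB
    obtain ⟨j, hj, rfl⟩ := mem_image.1 hB
    simpa using (mem_filter.1 hj).2.symm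
  bos_disjoint := by
    intro B hB C hC hne
    obtain ⟨j, hj, rfl⟩ := mem_image.1 hB
    obtain ⟨k, hk, rfl⟩ := mem_image.1 hC
    simpa using hne
  cover j hj := Or.inr ⟨{j}, mem_image_of_mem _ (mem_filter.2 ⟨mem_univ _, hj⟩), mem_singleton_self j⟩

/-- The finite set of all `K` with `K ⊑ L`. -/
def finer (L : PSC n m) : Finset (PSC n m) := univ.filter fun K => K ≤ L

/-- The Möbius function of `(sC_{n,m}, ⊑)`, with rational values. -/
def mu (K L : PSC n m) : ℚ := IncidenceAlgebra.mu ℚ K L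

/-- `μ(0̂_{n,m}, K)`. -/
def muZero (K : PSC n m) : ℚ := mu (zeroHat n m K.df_le) K

/-- The sign `(-1)^K`, the product of `(-1)^(|B| - 1)` over all blocks `B` of `K`. -/
def sign (K : PSC n m) : ℚ :=
  (∏ i, (-1 : ℚ) ^ ((K.fer i).card - 1)) * ∏ B ∈ K.bos, (-1 : ℚ) ^ (B.card - 1)

/-- `K!`, the product of `|B|!` over all blocks `B` of `K`: the number of ways to sort the elements
of all blocks of `K` simultaneously. -/
def blockFactorial (K : PSC n m) : ℕ :=
  (∏ i, (K.fer i).card.factorial) * ∏ B ∈ K.bos, B.card.factorial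

/-- Minimum of a set of labels, with the convention `min ∅ = 0`. -/
def minOrZero (A : Finset (Fin (n + 1))) : Fin (n + 1) :=
  if h : A.Nonempty then A.min' h else 0

/-- Set superpartitions: `I_i ≠ I_j` and `min (I_i \ I_j) < min (I_j \ I_i)` for `i < j`, where
`min ∅ = 0`.  Pairs of blocks involving a nonfermionic one satisfy this automatically. -/
def IsSetSuperpartition (I : PSC n m) : Prop :=
  ∀ i j : Fin m, i < j → I.fer i ≠ I.fer j ∧
    minOrZero (I.fer i \ I.fer j) < minOrZero (I.fer j \ I.fer i)

end PSC

/-- The set `sP_{n,m}` of set superpartitions of bidegree `(n, m)`. -/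
abbrev SetSuperpartition (n m : ℕ) : Type := {I : PSC n m // I.IsSetSuperpartition}

/-! ## Functions in superspace -/

/-- Monomials in normal form: `(A, w)` stands for `θ_{c_1} ⋯ θ_{c_r} x_{w_1} ⋯ x_{w_s}`, where
`c_1 < ⋯ < c_r` are the elements of `A`.  Using `x_i θ_j = θ_j x_i` and `θ_i θ_j = - θ_j θ_i`, every
monomial is uniquely a scalar multiple of one of these, or zero. -/
abbrev SMonomial : Type := Finset ℕ+ × List ℕ+

/-- The scalar `q` with `θ_{a_1} ⋯ θ_{a_m} = q θ_{c_1} ⋯ θ_{c_r}`, where `c_1 < ⋯ < c_r` are the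
elements of `A`, and `q = 0` if there is none: by anticommutativity `q = sgn π` if `a_i = c_{π(i)}`
for a permutation `π`. -/
def thetaCoeff {m : ℕ} (a : Fin m → ℕ+) (A : Finset ℕ+) : ℚ :=
  if h : A.card = m then
    ∑ π : Equiv.Perm (Fin m),
      if ∀ i, a i = A.orderEmbOfFin h (π i) then ((Equiv.Perm.sign π : ℤ) : ℚ) else 0
  else 0

/-- The coefficient of the normal-form monomial `u` in `θ_{a_1} ⋯ θ_{a_m} x_{b_1} ⋯ x_{b_n}`. -/
def monomialCoeff {n m : ℕ} (a : Fin m → ℕ+) (b : Fin n → ℕ+) (u : SMonomial) : ℚ :=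
  if List.ofFn b = u.2 then thetaCoeff a u.1 else 0

/-- Functions in superspace: formal rational series of bounded degree in the variables. -/
def superspace : Submodule ℚ (SMonomial → ℚ) where
  carrier := {f | ∃ d : ℕ, ∀ u : SMonomial, f u ≠ 0 → u.1.card + u.2.length ≤ d}
  zero_mem' := ⟨0, fun u h => (h rfl).elim⟩
  add_mem' := by
    rintro f g ⟨d, hf⟩ ⟨e, hg⟩
    refine ⟨max d e, fun u hu => ?_⟩
    by_cases h : f u = 0
    · by_cases h' : g u = 0
      · exact (hu (by simp [h, h'])).elim
      · exact (hg u h').trans (le_max_right _ _)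
    · exact (hf u h).trans (le_max_left _ _)
  smul_mem' := by
    rintro c f ⟨d, hf⟩
    exact ⟨d, fun u hu => hf u fun h => hu (by simp [h])⟩

/-- The linear action of a permutation `s` of the indices, `s(x_i) = x_{s(i)}`,
`s(θ_i) = θ_{s(i)}`, given by coefficients: the normal-form monomial `(B, v)`, with
`B = {c_1 < ⋯ < c_r}`, is sent to `θ_{s(c_1)} ⋯ θ_{s(c_r)} x_{s(v_1)} ⋯`. -/
def permAct (s : Equiv.Perm ℕ+) : (SMonomial → ℚ) →ₗ[ℚ] (SMonomial → ℚ) where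
  toFun f u :=
    thetaCoeff (fun i => s ((u.1.image s.symm).orderEmbOfFin rfl i)) u.1 *
      f (u.1.image s.symm, u.2.map s.symm)
  map_add' f g := by
    ext u
    simp [mul_add]
  map_smul' c f := by
    ext u
    simp [mul_left_comm]

/-- `sNCSym`: the functions in superspace invariant under `𝔖_N` for all `N`. -/
def sNCSym : Submodule ℚ (SMonomial → ℚ) where
  carrier := {f | f ∈ superspace ∧
    ∀ (N : ℕ+) (s : Equiv.Perm ℕ+), (∀ i, N < i → s i = i) → permAct s f = f}
  zero_mem' := ⟨superspace.zero_mem, fun _ s _ => map_zero (permAct s)⟩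
  add_mem' := by
    rintro f g ⟨hf, hf'⟩ ⟨hg, hg'⟩
    exact ⟨superspace.add_mem hf hg, fun N s hs => by rw [map_add, hf' N s hs, hg' N s hs]⟩
  smul_mem' := by
    rintro c f ⟨hf, hf'⟩
    exact ⟨superspace.smul_mem c hf, fun N s hs => by rw [map_smul, hf' N s hs]⟩

/-- The formal series `∑_{(a, b)} c(a, b) θ_{a_1} ⋯ θ_{a_m} x_{b_1} ⋯ x_{b_n}`.  Each coefficient is
a sum with finitely many nonzero terms. -/
def formalSum {n m : ℕ} (c : (Fin m → ℕ+) → (Fin n → ℕ+) → ℚ) : SMonomial → ℚ := fun u =>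
  ∑ᶠ ab : (Fin m → ℕ+) × (Fin n → ℕ+), c ab.1 ab.2 * monomialCoeff ab.1 ab.2 u

lemma thetaCoeff_ne_zero {m : ℕ} {a : Fin m → ℕ+} {A : Finset ℕ+} (h : thetaCoeff a A ≠ 0) :
    A.card = m ∧ ∀ i, a i ∈ A := by
  unfold thetaCoeff at h
  split_ifs at h with hA
  · refine ⟨hA, fun i => ?_⟩
    obtain ⟨π, -, hπ⟩ := Finset.exists_ne_zero_of_sum_ne_zero h
    split_ifs at hπ with h'
    · rw [h' i]
      exact orderEmbOfFin_mem _ _ _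
    · exact (hπ rfl).elim
  · exact (h rfl).elim

lemma formalSum_support {n m : ℕ} (c : (Fin m → ℕ+) → (Fin n → ℕ+) → ℚ) (u : SMonomial) :
    Function.support (fun ab : (Fin m → ℕ+) × (Fin n → ℕ+) =>
      c ab.1 ab.2 * monomialCoeff ab.1 ab.2 u) ⊆
      ((Fintype.piFinset fun _ : Fin m => u.1) ×ˢ
        (Fintype.piFinset fun _ : Fin n => u.2.toFinset) : Finset _) := by
  rintro ⟨a, b⟩ h
  have h2 : monomialCoeff a b u ≠ 0 := fun h' => h (by simp [h'])
  unfold monomialCoeff at h2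
  split_ifs at h2 with hb
  · simp only [coe_product, Set.mem_prod, mem_coe, Fintype.mem_piFinset]
    refine ⟨(thetaCoeff_ne_zero h2).2, fun i => ?_⟩
    rw [← hb]
    simp
  · exact (h2 rfl).elim

/-- Only finitely many terms contribute to each coefficient of `formalSum c`. -/
lemma formalSum_eq_sum {n m : ℕ} (c : (Fin m → ℕ+) → (Fin n → ℕ+) → ℚ) (u : SMonomial) :
    formalSum c u =
      ∑ ab ∈ (Fintype.piFinset fun _ : Fin m => u.1) ×ˢ
        (Fintype.piFinset fun _ : Fin n => u.2.toFinset),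
        c ab.1 ab.2 * monomialCoeff ab.1 ab.2 u :=
  finsum_eq_sum_of_support_subset _ (formalSum_support c u)

lemma formalSum_mem_superspace {n m : ℕ} (c : (Fin m → ℕ+) → (Fin n → ℕ+) → ℚ) :
    formalSum c ∈ superspace := by
  refine ⟨m + n, fun u hu => ?_⟩
  rw [formalSum_eq_sum] at hu
  obtain ⟨⟨a, b⟩, -, h⟩ := Finset.exists_ne_zero_of_sum_ne_zero hu
  have h2 : monomialCoeff a b u ≠ 0 := fun h' => h (by simp [h'])
  unfold monomialCoeff at h2
  split_ifs at h2 with hb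
  · rw [(thetaCoeff_ne_zero h2).1, ← hb]
    simp
  · exact (h2 rfl).elim

lemma thetaCoeff_perm {m : ℕ} (s : Equiv.Perm ℕ+) (a : Fin m → ℕ+) (A B : Finset ℕ+)
    (hB : B = A.image s.symm) :
    thetaCoeff (fun i => s (B.orderEmbOfFin rfl i)) A * thetaCoeff a B =
      thetaCoeff (fun i => s (a i)) A := by
  have hc : B.card = A.card := by rw [hB, card_image_of_injective _ s.symm.injective]
  by_cases hm : A.card = m
  swap
  · have hm' : ¬ B.card = m := by rwa [hc]
    simp [thetaCoeff, hm, hm']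
  have hBm : B.card = m := by rw [hc, hm]
  subst hBm
  have hmem : ∀ i, s (B.orderEmbOfFin rfl i) ∈ A := by
    intro i
    have h : ∀ x ∈ B, s x ∈ A := by
      intro x hx
      rw [hB, mem_image] at hx
      obtain ⟨y, hy, rfl⟩ := hx
      simpa using hy
    exact h _ (orderEmbOfFin_mem B rfl i)
  have hex : ∀ i, ∃ j, A.orderEmbOfFin hm j = s (B.orderEmbOfFin rfl i) := by
    intro i
    have : s (B.orderEmbOfFin rfl i) ∈ Set.range (A.orderEmbOfFin hm) := by
      rw [range_orderEmbOfFin]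
      exact hmem i
    exact this
  choose t ht using hex
  have tinj : Function.Injective t := by
    intro i j hij
    have : s (B.orderEmbOfFin rfl i) = s (B.orderEmbOfFin rfl j) := by rw [← ht, ← ht, hij]
    simpa using this
  let τ : Equiv.Perm (Fin B.card) := Equiv.ofBijective t (Finite.injective_iff_bijective.1 tinj)
  have hτ : ∀ i, s (B.orderEmbOfFin rfl i) = A.orderEmbOfFin hm (τ i) := fun i => (ht i).symm
  have h1 : thetaCoeff (fun i => s (B.orderEmbOfFin rfl i)) A =
      ((Equiv.Perm.sign τ : ℤ) : ℚ) := by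
    unfold thetaCoeff
    rw [dif_pos hm, Finset.sum_eq_single τ]
    · rw [if_pos hτ]
    · intro π _ hπ
      rw [if_neg]
      intro h
      refine hπ (Equiv.ext fun i => ?_)
      exact (A.orderEmbOfFin hm).injective ((h i).symm.trans (hτ i))
    · intro h
      exact (h (mem_univ _)).elim
  rw [h1]
  unfold thetaCoeff
  rw [dif_pos rfl, dif_pos hm, Finset.mul_sum]
  refine Fintype.sum_equiv (Equiv.mulLeft τ) _ _ fun π => ?_
  have : (∀ i, s (a i) = A.orderEmbOfFin hm ((Equiv.mulLeft τ π) i)) ↔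
      ∀ i, a i = B.orderEmbOfFin rfl (π i) := by
    refine forall_congr' fun i => ?_
    simp [← hτ]
  simp only [this]
  split_ifs <;> simp

lemma permAct_formalSum {n m : ℕ} (c : (Fin m → ℕ+) → (Fin n → ℕ+) → ℚ) (s : Equiv.Perm ℕ+)
    (hc : ∀ a b, c (fun i => s (a i)) (fun i => s (b i)) = c a b) :
    permAct s (formalSum c) = formalSum c := by
  ext u
  let e : (Fin m → ℕ+) × (Fin n → ℕ+) ≃ (Fin m → ℕ+) × (Fin n → ℕ+) :=
    Equiv.prodCongr (Equiv.arrowCongr (Equiv.refl _) s) (Equiv.arrowCongr (Equiv.refl _) s)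
  have key : ∀ ab : (Fin m → ℕ+) × (Fin n → ℕ+),
      c (e ab).1 (e ab).2 * monomialCoeff (e ab).1 (e ab).2 u =
        thetaCoeff (fun i => s ((u.1.image s.symm).orderEmbOfFin rfl i)) u.1 *
          (c ab.1 ab.2 * monomialCoeff ab.1 ab.2 (u.1.image s.symm, u.2.map s.symm)) := by
    rintro ⟨a, b⟩
    have h1 : (e (a, b)).1 = fun i => s (a i) := rfl
    have h2 : (e (a, b)).2 = fun i => s (b i) := rfl
    rw [h1, h2, hc]
    have h3 : (List.ofFn (fun i => s (b i)) = u.2) ↔ (List.ofFn b = u.2.map s.symm) := by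
      have h4 : List.ofFn (fun i => s (b i)) = (List.ofFn b).map s := by
        rw [List.map_ofFn]
        rfl
      rw [h4]
      constructor
      · intro h
        rw [← h, List.map_map]
        simp
      · intro h
        rw [h, List.map_map]
        simp
    unfold monomialCoeff
    simp only [h3]
    split_ifs
    · rw [← thetaCoeff_perm s a u.1 _ rfl]
      ring
    · simp
  have h5 : formalSum c u = ∑ᶠ ab, c (e ab).1 (e ab).2 * monomialCoeff (e ab).1 (e ab).2 u :=
    (finsum_comp_equiv e
      (f := fun ab : (Fin m → ℕ+) × (Fin n → ℕ+) =>
        c ab.1 ab.2 * monomialCoeff ab.1 ab.2 u)).symm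
  rw [h5]
  simp only [key]
  rw [← mul_finsum]
  rfl

lemma formalSum_mem_sNCSym {n m : ℕ} (c : (Fin m → ℕ+) → (Fin n → ℕ+) → ℚ)
    (hc : ∀ (s : Equiv.Perm ℕ+) a b, c (fun i => s (a i)) (fun i => s (b i)) = c a b) :
    formalSum c ∈ sNCSym :=
  ⟨formalSum_mem_superspace c, fun _ s _ => permAct_formalSum c s (hc s)⟩

/-! ## Power sum, elementary and complete homogeneous functions -/

namespace PSC

variable {n m : ℕ}

/-- `θ_{a_1} ⋯ θ_{a_m} x_{b_1} ⋯ x_{b_n} ∈ M(K)`: `a_i = b_j` iff `j ∈ K_i`, and `b_i = b_j` iff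
`i, j` belong to the same block of `K`.  (The position `j ∈ [n]` is `j.succ` in `Fin (n + 1)`.) -/
def InM (K : PSC n m) (a : Fin m → ℕ+) (b : Fin n → ℕ+) : Prop :=
  (∀ i j, a i = b j ↔ j.succ ∈ K.fer i) ∧ ∀ i j, b i = b j ↔ K.SameBlock i.succ j.succ

/-- Membership in `P(K)`: `a_i = b_j` if `j ∈ K_i`, and `b_i = b_j` if `i, j` belong to the same
block of `K`. -/
def InP (K : PSC n m) (a : Fin m → ℕ+) (b : Fin n → ℕ+) : Prop :=
  (∀ i j, j.succ ∈ K.fer i → a i = b j) ∧ ∀ i j, K.SameBlock i.succ j.succ → b i = b j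

/-- Membership in `E(K)`: `a_i ≠ b_j` if `j ∈ K_i`, and `b_i ≠ b_j` if `i ≠ j` belong to the same
block of `K`. -/
def InE (K : PSC n m) (a : Fin m → ℕ+) (b : Fin n → ℕ+) : Prop :=
  (∀ i j, j.succ ∈ K.fer i → a i ≠ b j) ∧
    ∀ i j, i ≠ j → K.SameBlock i.succ j.succ → b i ≠ b j

lemma inM_perm (K : PSC n m) (s : Equiv.Perm ℕ+) (a : Fin m → ℕ+) (b : Fin n → ℕ+) :
    K.InM (fun i => s (a i)) (fun i => s (b i)) ↔ K.InM a b := by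
  simp [InM]

lemma inP_perm (K : PSC n m) (s : Equiv.Perm ℕ+) (a : Fin m → ℕ+) (b : Fin n → ℕ+) :
    K.InP (fun i => s (a i)) (fun i => s (b i)) ↔ K.InP a b := by
  simp [InP]

lemma inE_perm (K : PSC n m) (s : Equiv.Perm ℕ+) (a : Fin m → ℕ+) (b : Fin n → ℕ+) :
    K.InE (fun i => s (a i)) (fun i => s (b i)) ↔ K.InE a b := by
  simp [InE]

end PSC

/-- `θ_{a_1} ⋯ θ_{a_m} x_{b_1} ⋯ x_{b_n}` is null-symmetric: `{a_1, …, a_m} \ {b_1, …, b_n}` has more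
than one element. -/
def NullSymmetric {n m : ℕ} (a : Fin m → ℕ+) (b : Fin n → ℕ+) : Prop :=
  1 < (univ.image a \ univ.image b).card

/-- The coefficient `c_u` of `u = θ_{a_1} ⋯ θ_{a_m} x_{b_1} ⋯ x_{b_n}` in `h_K`: the number of ways to
sort the elements of the blocks of `K ⊓ L` simultaneously, where `L` is the unique partial set
supercomposition with `u ∈ M(L)`; null-symmetric monomials do not occur. -/
def hCoeff {n m : ℕ} (K : PSC n m) (a : Fin m → ℕ+) (b : Fin n → ℕ+) : ℚ :=
  if NullSymmetric a b then 0
  else ∑ L ∈ univ.filter (fun L : PSC n m => L.InM a b), ((K ⊓ L).blockFactorial : ℚ)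

lemma nullSymmetric_perm {n m : ℕ} (s : Equiv.Perm ℕ+) (a : Fin m → ℕ+) (b : Fin n → ℕ+) :
    NullSymmetric (fun i => s (a i)) (fun i => s (b i)) ↔ NullSymmetric a b := by
  have h : (univ.image fun i => s (a i)) \ (univ.image fun i => s (b i)) =
      (univ.image a \ univ.image b).image s := by
    rw [Finset.image_sdiff _ _ s.injective, Finset.image_image, Finset.image_image]
    rfl
  unfold NullSymmetric
  rw [h, card_image_of_injective _ s.injective]

lemma hCoeff_perm {n m : ℕ} (K : PSC n m) (s : Equiv.Perm ℕ+) (a : Fin m → ℕ+)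
    (b : Fin n → ℕ+) : hCoeff K (fun i => s (a i)) (fun i => s (b i)) = hCoeff K a b :=
  if_congr (nullSymmetric_perm s a b) rfl
    (Finset.sum_congr (Finset.filter_congr fun L _ => L.inM_perm s a b) fun _ _ => rfl)

/-- The power sum function `p_K`. -/
def pFun {n m : ℕ} (K : PSC n m) : sNCSym :=
  ⟨formalSum fun a b => if K.InP a b then 1 else 0,
    formalSum_mem_sNCSym _ fun s a b => if_congr (PSC.inP_perm K s a b) rfl rfl⟩

/-- The elementary function `e_K`. -/
def eFun {n m : ℕ} (K : PSC n m) : sNCSym :=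
  ⟨formalSum fun a b => if K.InE a b then 1 else 0,
    formalSum_mem_sNCSym _ fun s a b => if_congr (PSC.inE_perm K s a b) rfl rfl⟩

/-- The complete homogeneous function `h_K`. -/
def hFun {n m : ℕ} (K : PSC n m) : sNCSym :=
  ⟨formalSum fun a b => hCoeff K a b,
    formalSum_mem_sNCSym _ fun s a b => hCoeff_perm K s a b⟩

end SuperNC

end

noncomputable section

namespace SuperNC

open Finset
open scoped Classical

namespace PSC

variable {n m : ℕ}

/-! ### The block of a position -/

/-! All six expansions are checked coefficient by coefficient. A monomial with distinct θ-indices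
that is not null-symmetric has a unique type `N`, and membership in `P(K)` and `E(K)` depends only
on `N`: it means `K ≤ N`, respectively `K ⊓ N = 0̂`, while the coefficient in `h_K` is `(K ⊓ N)!`.
The remaining monomials may be ignored: a repeated θ gives zero, and exchanging two θ-indices absent
from the word shows that null-symmetric coefficients of an element of `sNCSym` vanish
(`sNCSym_apply_eq_zero`, `formalSum_congr`, `sum_smul_congr`).

Since `K ≤ I` and `K ≤ N` together mean `K ≤ I ⊓ N`, the expansion of `e_I` is the defining
recursion of μ, and that of `h_I` is the identity `∑_{K ≤ L} |μ(0̂, K)| = L!` (`sum_abs_muZero`).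
The latter comes from colourings: counting the words of `E(L)` over a finite alphabet directly, and
by Möbius inversion through the words of `P(K)`, gives a polynomial identity in the alphabet size
(`sum_muZero_X_pow`). Its lowest coefficient evaluates `μ(0̂, L)` and its sign; its value at -1 is
the required sum. The other four expansions follow by Möbius inversion and `μ(0̂, K) = (-1)^K |μ(0̂,
K)|`. None of this needs `I` to be a set superpartition.

For ω, every element of `sNCSym` expands in the monomial functions `m_K`, with a factor `1 / m!` for
the orderings of the θ's. The `m_K` are not independent, since permuting fermionic blocks only
changes the sign; but the expansion has canonical coefficients (`typeCoeff`), so replacing `m_K` by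
`q_K = ∑_{L ≥ K} μ(K, L) (-1)^L p_L` is a well-defined linear map. As `q_K` alternates in the same
way, this map sends `m_K` to `q_K`, hence `p_K` to `(-1)^K p_K` and `e_K` to `h_K`. The `p_K` span,
so ω² = 1. For uniqueness, alternation recovers every `e_K` from the set superpartitions, and the
`e_K` give the `p_K`. -/

lemma exists_block (K : PSC n m) (j : Fin n) : ∃ x : Fin m ⊕ {B // B ∈ K.bos},
    (∀ i, x = Sum.inl i ↔ j.succ ∈ K.fer i) ∧ ∀ B, x = Sum.inr B ↔ j.succ ∈ B.1 := by
  rcases K.cover j.succ (Fin.succ_ne_zero j) with ⟨i, hi⟩ | ⟨B, hB, hj⟩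
  · refine ⟨Sum.inl i, fun i' => ?_, fun B => ?_⟩
    · rw [Sum.inl.injEq]
      exact ⟨fun h => h ▸ hi, fun h => K.fer_unique (Fin.succ_ne_zero j) hi h⟩
    · simpa using fun h => K.fer_bos_false B.2 hi h
  · refine ⟨Sum.inr ⟨B, hB⟩, fun i' => ?_, fun C => ?_⟩
    · simpa using fun h => K.fer_bos_false hB h hj
    · rw [Sum.inr.injEq]
      exact ⟨fun h => h ▸ hj, fun h => Subtype.ext (K.bos_unique hB C.2 hj h)⟩

/-- The block of `K` that contains the position `j`. -/
def blk (K : PSC n m) (j : Fin n) : Fin m ⊕ {B // B ∈ K.bos} := (K.exists_block j).choose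

lemma blk_eq_inl (K : PSC n m) {j : Fin n} {i : Fin m} :
    K.blk j = Sum.inl i ↔ j.succ ∈ K.fer i := (K.exists_block j).choose_spec.1 i

lemma blk_eq_inr (K : PSC n m) {j : Fin n} {B : {B // B ∈ K.bos}} :
    K.blk j = Sum.inr B ↔ j.succ ∈ B.1 := (K.exists_block j).choose_spec.2 B

lemma sameBlock_iff_blk (K : PSC n m) {j k : Fin n} :
    K.SameBlock j.succ k.succ ↔ K.blk j = K.blk k := by
  constructor
  · rintro (⟨i, h1, h2⟩ | ⟨B, hB, h1, h2⟩)
    · rw [K.blk_eq_inl.2 h1, K.blk_eq_inl.2 h2]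
    · rw [(K.blk_eq_inr (B := ⟨B, hB⟩)).2 h1, (K.blk_eq_inr (B := ⟨B, hB⟩)).2 h2]
  · intro h
    rcases hx : K.blk j with i | B
    · exact Or.inl ⟨i, K.blk_eq_inl.1 hx, K.blk_eq_inl.1 (h ▸ hx)⟩
    · exact Or.inr ⟨B.1, B.2, K.blk_eq_inr.1 hx, K.blk_eq_inr.1 (h ▸ hx)⟩

lemma exists_blk_eq_inr (K : PSC n m) (B : {B // B ∈ K.bos}) : ∃ j, K.blk j = Sum.inr B := by
  obtain ⟨j, hj⟩ := K.bos_nonempty B.1 B.2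
  have h0 : j ≠ 0 := fun h => K.zero_notMem_bos B.1 B.2 (h ▸ hj)
  obtain ⟨j, rfl⟩ := Fin.exists_succ_eq.2 h0
  exact ⟨j, K.blk_eq_inr.2 hj⟩

lemma card_filter_succ_mem (A : Finset (Fin (n + 1))) :
    (univ.filter fun j : Fin n => j.succ ∈ A).card = (A.erase 0).card := by
  rw [← card_image_of_injective _ (Fin.succ_injective n)]
  congr 1
  ext j
  simp only [mem_image, mem_filter, mem_univ, true_and, mem_erase]
  constructor
  · rintro ⟨k, hk, rfl⟩
    exact ⟨Fin.succ_ne_zero k, hk⟩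
  · rintro ⟨h0, hj⟩
    obtain ⟨k, rfl⟩ := Fin.exists_succ_eq.2 h0
    exact ⟨k, hj, rfl⟩

lemma card_fiber_inl (K : PSC n m) (i : Fin m) :
    Fintype.card {j // K.blk j = Sum.inl i} = (K.fer i).card - 1 := by
  rw [← card_erase_of_mem (K.zero_mem_fer i), ← card_filter_succ_mem, Fintype.card_subtype]
  simp only [blk_eq_inl]

lemma card_fiber_inr (K : PSC n m) (B : {B // B ∈ K.bos}) :
    Fintype.card {j // K.blk j = Sum.inr B} = B.1.card := by
  rw [← erase_eq_of_notMem (K.zero_notMem_bos B.1 B.2), ← card_filter_succ_mem,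
    Fintype.card_subtype]
  simp only [blk_eq_inr]

/-- The `n` positions are counted by block; a fermionic block loses one element because 0 is not a
position. -/
lemma card_add_sum_card (K : PSC n m) :
    ∑ i, ((K.fer i).card - 1) + ∑ B ∈ K.bos, B.card = n := by
  have h := Fintype.card_congr (Equiv.sigmaFiberEquiv K.blk)
  rw [Fintype.card_sigma, Fintype.sum_sum_type, Fintype.card_fin] at h
  simp only [card_fiber_inl, card_fiber_inr] at h
  rw [← sum_coe_sort K.bos]
  exact h

/-! ### Monomial types -/

lemma le_iff_succ (K L : PSC n m) : K ≤ L ↔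
    (∀ i (j : Fin n), j.succ ∈ K.fer i → j.succ ∈ L.fer i) ∧
      ∀ j k : Fin n, K.SameBlock j.succ k.succ → L.SameBlock j.succ k.succ := by
  rw [le_iff]
  refine and_congr (forall_congr' fun i => ?_) ?_
  · refine ⟨fun h j hj => h hj, fun h j hj => ?_⟩
    rcases Fin.eq_zero_or_eq_succ j with rfl | ⟨k, rfl⟩
    · exact L.zero_mem_fer i
    · exact h k hj
  · refine ⟨fun h j k => h _ _ (Fin.succ_ne_zero j) (Fin.succ_ne_zero k), fun h j k hj hk => ?_⟩
    obtain ⟨j, rfl⟩ := Fin.exists_succ_eq.2 hj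
    obtain ⟨k, rfl⟩ := Fin.exists_succ_eq.2 hk
    exact h j k

/-- The equalities among the indices are exactly those recorded by `N`, so those demanded by `K`
hold precisely when `N` is coarser. -/
lemma InM.inP_iff {N : PSC n m} {a : Fin m → ℕ+} {b : Fin n → ℕ+} (h : N.InM a b)
    (K : PSC n m) : K.InP a b ↔ K ≤ N := by
  simp only [le_iff_succ, InP, h.1, h.2]

lemma InM.unique {K L : PSC n m} {a : Fin m → ℕ+} {b : Fin n → ℕ+} (hK : K.InM a b)
    (hL : L.InM a b) : K = L :=
  le_antisymm ((hL.inP_iff K).1 ((hK.inP_iff K).2 le_rfl))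
    ((hK.inP_iff L).1 ((hL.inP_iff L).2 le_rfl))

lemma zeroHat_sameBlock (hm : m ≤ n + 1) {j k : Fin (n + 1)} (hj : j ≠ 0) :
    (zeroHat n m hm).SameBlock j k ↔ j = k := by
  constructor
  · rintro (⟨i, h1, h2⟩ | ⟨B, hB, h1, h2⟩)
    · exact absurd (mem_singleton.1 h1) hj
    · obtain ⟨l, hl, rfl⟩ := mem_image.1 hB
      rw [mem_singleton.1 h1, mem_singleton.1 h2]
  · rintro rfl
    exact sameBlock_refl _ hj

lemma zeroHat_le (K : PSC n m) (hm : m ≤ n + 1) : zeroHat n m hm ≤ K := by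
  rw [le_iff_succ]
  refine ⟨fun i j hj => absurd (mem_singleton.1 hj) (Fin.succ_ne_zero j), fun j k h => ?_⟩
  rw [zeroHat_sameBlock hm (Fin.succ_ne_zero j)] at h
  rw [← h]
  exact sameBlock_refl _ (Fin.succ_ne_zero j)

/-- The equalities forbidden by `K` are avoided precisely when `K` and `N` have no nontrivial
coincidence in common. -/
lemma InM.inE_iff {N : PSC n m} {a : Fin m → ℕ+} {b : Fin n → ℕ+} (h : N.InM a b)
    (K : PSC n m) : K.InE a b ↔ K ⊓ N = zeroHat n m K.df_le := by
  have h0 : K ⊓ N = zeroHat n m K.df_le ↔ K ⊓ N ≤ zeroHat n m K.df_le :=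
    ⟨le_of_eq, fun h => le_antisymm h (zeroHat_le _ _)⟩
  rw [h0, le_iff_succ]
  refine and_congr (forall_congr' fun i => forall_congr' fun j => ?_)
    (forall_congr' fun j => forall_congr' fun k => ?_)
  · have h1 : j.succ ∈ (K ⊓ N).fer i ↔ j.succ ∈ K.fer i ∧ j.succ ∈ N.fer i := mem_inter
    have h2 : j.succ ∈ (zeroHat n m K.df_le).fer i ↔ False := by simp [zeroHat]
    rw [h1, h2, ne_eq, h.1]
    tauto
  · have h1 : (K ⊓ N).SameBlock j.succ k.succ ↔ _ :=
      meet_sameBlock K N (Fin.succ_ne_zero j) (Fin.succ_ne_zero k)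
    rw [h1, zeroHat_sameBlock _ (Fin.succ_ne_zero j), Fin.succ_inj, ne_eq (b j), h.2]
    tauto

/-- Injectivity of `a` is what makes two fermionic blocks meet only in 0. -/
lemma exists_inM (hm : m ≤ n + 1) {a : Fin m → ℕ+} (ha : Function.Injective a)
    (b : Fin n → ℕ+) : ∃ N : PSC n m, N.InM a b := by
  let N : PSC n m :=
    { fer := fun i => insert 0 ((univ.filter fun j => a i = b j).image Fin.succ)
      bos := (univ.filter fun j => ∀ i, a i ≠ b j).image fun j =>
        (univ.filter fun k => b j = b k).image Fin.succ
      df_le := hm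
      zero_mem_fer := fun i => mem_insert_self _ _
      zero_notMem_bos := by
        intro B hB
        obtain ⟨j, hj, rfl⟩ := mem_image.1 hB
        simp
      bos_nonempty := by
        intro B hB
        obtain ⟨j, hj, rfl⟩ := mem_image.1 hB
        exact ⟨j.succ, mem_image_of_mem _ (by simp)⟩
      fer_inter_fer := by
        intro i i' hii j hj
        rcases Fin.eq_zero_or_eq_succ j with rfl | ⟨k, rfl⟩
        · simp
        · simp only [mem_inter, mem_insert, mem_image, mem_filter, mem_univ, true_and,
            Fin.succ_ne_zero, false_or, Fin.succ_inj, exists_eq_right] at hj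
          exact (hii (ha (hj.1.trans hj.2.symm))).elim
      fer_disjoint_bos := by
        intro i B hB
        obtain ⟨j, hj, rfl⟩ := mem_image.1 hB
        rw [Finset.disjoint_left]
        intro k hk hk'
        obtain ⟨k, hk1, rfl⟩ := mem_image.1 hk'
        simp only [mem_insert, mem_image, mem_filter, mem_univ, true_and,
            Fin.succ_ne_zero, false_or, Fin.succ_inj, exists_eq_right] at hk hk1 hj
        exact hj i (hk.trans hk1.symm)
      bos_disjoint := by
        intro B hB C hC hne
        obtain ⟨j, hj, rfl⟩ := mem_image.1 hB
        obtain ⟨l, hl, rfl⟩ := mem_image.1 hC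
        rw [Finset.disjoint_left]
        intro k hk hk'
        obtain ⟨k, hk1, rfl⟩ := mem_image.1 hk
        simp only [mem_image, mem_filter, mem_univ, true_and,
            Fin.succ_inj, exists_eq_right] at hk' hk1
        exact hne (by rw [hk1, hk'])
      cover := by
        intro j hj
        obtain ⟨j, rfl⟩ := Fin.exists_succ_eq.2 hj
        by_cases h : ∃ i, a i = b j
        · obtain ⟨i, hi⟩ := h
          exact Or.inl ⟨i, mem_insert_of_mem (mem_image_of_mem _ (by simpa using hi))⟩
        · push Not at h
          exact Or.inr ⟨_, mem_image_of_mem _ (mem_filter.2 ⟨mem_univ _, h⟩),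
            mem_image_of_mem _ (by simp)⟩ }
  have hf : ∀ i j, a i = b j ↔ j.succ ∈ N.fer i := by
    intro i j
    simp [N, Fin.succ_ne_zero]
  refine ⟨N, hf, fun j k => ⟨fun h => ?_, ?_⟩⟩
  · rcases N.cover j.succ (Fin.succ_ne_zero j) with ⟨i, hi⟩ | ⟨B, hB, hj⟩
    · exact Or.inl ⟨i, hi, (hf i k).1 (((hf i j).2 hi).trans h)⟩
    · refine Or.inr ⟨B, hB, hj, ?_⟩
      obtain ⟨l, hl, rfl⟩ := mem_image.1 hB
      simp only [mem_image, mem_filter, mem_univ, true_and,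
            Fin.succ_inj, exists_eq_right] at hj ⊢
      exact hj.trans h
  · rintro (⟨i, h1, h2⟩ | ⟨B, hB, h1, h2⟩)
    · exact ((hf i j).2 h1).symm.trans ((hf i k).2 h2)
    · obtain ⟨l, hl, rfl⟩ := mem_image.1 hB
      simp only [mem_image, mem_filter, mem_univ, true_and,
            Fin.succ_inj, exists_eq_right] at h1 h2
      exact h1.symm.trans h2

/-- The indices `1, …, m`. -/
def stdTheta (m : ℕ) (i : Fin m) : ℕ+ := Nat.succPNat i

lemma stdTheta_strictMono (m : ℕ) : StrictMono (stdTheta m) := fun i j h => by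
  have h' : (i : ℕ) < j := h
  simpa [stdTheta] using h'

/-- A word `b` such that `θ_1 ⋯ θ_m x_{b_1} ⋯ x_{b_n}` has type `K`. -/
def stdWord (K : PSC n m) (j : Fin n) : ℕ+ :=
  Sum.elim (stdTheta m) (fun B => Nat.succPNat (m + Fintype.equivFin {B // B ∈ K.bos} B)) (K.blk j)

lemma stdWord_inM (K : PSC n m) : K.InM (stdTheta m) K.stdWord := by
  have hinj : Function.Injective (Sum.elim (stdTheta m)
      (fun B => Nat.succPNat (m + Fintype.equivFin {B // B ∈ K.bos} B))) := by
    refine Function.Injective.sumElim (stdTheta_strictMono m).injective ?_ ?_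
    · intro B C h
      simpa [Nat.succPNat_inj, Fin.val_inj] using h
    · intro i B h
      have := i.2
      simp only [stdTheta, Nat.succPNat_inj] at h
      omega
  refine ⟨fun i j => ?_, fun i j => ?_⟩
  · rw [← K.blk_eq_inl, eq_comm (b := Sum.inl i)]
    exact hinj.eq_iff (a := Sum.inl i)
  · rw [K.sameBlock_iff_blk]
    exact hinj.eq_iff

end PSC

namespace PSC

variable {n m : ℕ}

/-! ### Colourings and the Möbius function -/

/-- Such a word is constant on blocks: the letter on a fermionic block is forced by `a`, and that on
each nonfermionic block is free. -/
lemma card_inP (K : PSC n m) {a : Fin m → ℕ+} (S : Finset ℕ+) (ha : ∀ i, a i ∈ S) :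
    Fintype.card {b : Fin n → {c // c ∈ S} // K.InP a fun j => b j} = S.card ^ K.bos.card := by
  have h : Fintype.card ({B // B ∈ K.bos} → {c // c ∈ S}) = S.card ^ K.bos.card := by simp
  rw [← h]
  let a' : Fin m → {c // c ∈ S} := fun i => ⟨a i, ha i⟩
  refine (Fintype.card_congr (Equiv.ofBijective (fun g : {B // B ∈ K.bos} → {c // c ∈ S} =>
    (⟨fun j => Sum.elim a' g (K.blk j), fun i j hj => ?_, fun i j hij => ?_⟩ :
      {b : Fin n → {c // c ∈ S} // K.InP a fun j => b j})) ⟨fun g g' hg => ?_, ?_⟩)).symm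
  · simp [K.blk_eq_inl.2 hj, a']
  · simp only [K.sameBlock_iff_blk.1 hij]
  · funext B
    obtain ⟨j, hj⟩ := K.exists_blk_eq_inr B
    have := congrFun (Subtype.ext_iff.1 hg) j
    simpa [hj] using this
  · rintro ⟨b, hb⟩
    refine ⟨fun B => b (K.exists_blk_eq_inr B).choose, Subtype.ext (funext fun j => ?_)⟩
    rcases hx : K.blk j with i | B
    · apply Subtype.ext
      simpa [hx, a'] using hb.1 i j (K.blk_eq_inl.1 hx)
    · apply Subtype.ext
      have h := (K.exists_blk_eq_inr B).choose_spec
      simpa [hx] using hb.2 _ j (K.sameBlock_iff_blk.2 (h.trans hx.symm))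

/-- Such a word is an independent choice of injective colourings of the blocks, where the `i`-th
fermionic block must also avoid the colour `a i`. -/
lemma card_inE (K : PSC n m) {a : Fin m → ℕ+} (S : Finset ℕ+) (ha : ∀ i, a i ∈ S) :
    Fintype.card {b : Fin n → {c // c ∈ S} // K.InE a fun j => b j} =
      (∏ i, (S.card - 1).descFactorial ((K.fer i).card - 1)) *
        ∏ B ∈ K.bos, S.card.descFactorial B.card := by
  let T : Fin m ⊕ {B // B ∈ K.bos} → Type := fun x =>
    {c : {c // c ∈ S} // ∀ i, x = Sum.inl i → a i ≠ c}
  have e : {b : Fin n → {c // c ∈ S} // K.InE a fun j => b j} ≃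
      ∀ x : Fin m ⊕ {B // B ∈ K.bos}, {j // K.blk j = x} ↪ T x :=
    { toFun := fun b x =>
        ⟨fun j => ⟨b.1 j, fun i hi => b.2.1 i j (K.blk_eq_inl.1 (j.2.trans hi))⟩, by
          intro j k hjk
          by_contra hne
          have hjk' : ((b.1 j : {c // c ∈ S}) : ℕ+) = b.1 k :=
            congrArg (fun c : T x => (c.1 : ℕ+)) hjk
          exact b.2.2 j k (fun h => hne (Subtype.ext h))
            (K.sameBlock_iff_blk.2 (j.2.trans k.2.symm)) hjk'⟩
      invFun := fun g => ⟨fun j => (g (K.blk j) ⟨j, rfl⟩).1,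
        fun i j hj => (g (K.blk j) ⟨j, rfl⟩).2 i (K.blk_eq_inl.2 hj), by
          intro i j hij hs h
          rw [K.sameBlock_iff_blk] at hs
          -- The common block is a variable here, so that both positions lie in the domain of one
          -- embedding `g x`.
          have key : ∀ x (hi : K.blk i = x) (hj : K.blk j = x),
              (g x ⟨i, hi⟩).1 = (g x ⟨j, hj⟩).1 → i = j := by
            intro x hi hj h'
            simpa using (g x).injective (Subtype.ext h')
          refine hij (key _ hs rfl ?_)
          refine Eq.trans ?_ (Subtype.ext h)
          have : ∀ x (hx : K.blk i = x), (g x ⟨i, hx⟩).1 = (g (K.blk i) ⟨i, rfl⟩).1 := by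
            rintro x rfl
            rfl
          exact this _ _⟩
      left_inv := fun b => rfl
      right_inv := by
        intro g
        funext x
        ext ⟨j, hj⟩
        subst hj
        rfl }
  rw [Fintype.card_congr e, Fintype.card_pi, Fintype.prod_sum_type]
  simp only [Fintype.card_embedding_eq, card_fiber_inl, card_fiber_inr]
  rw [← prod_coe_sort K.bos]
  congr 1
  · refine prod_congr rfl fun i _ => ?_
    congr 1
    have : Fintype.card (T (Sum.inl i)) =
        Fintype.card {c : {c // c ∈ S} // c ≠ ⟨a i, ha i⟩} := by
      refine Fintype.card_congr (Equiv.subtypeEquivRight fun c => ?_)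
      simp [Subtype.ext_iff, eq_comm]
    rw [this]
    simp [Fintype.card_subtype_compl]
  · refine prod_congr rfl fun B _ => ?_
    congr 1
    have : Fintype.card (T (Sum.inr B)) = Fintype.card {c // c ∈ S} :=
      Fintype.card_congr (Equiv.subtypeUnivEquiv fun c => by simp)
    rw [this, Fintype.card_coe]

/-- Both cardinalities are exponents in word counts: `P(L)` lies in `P(K)`, strictly because the
standard word of `K` is not in `P(L)`. -/
lemma card_bos_lt {K L : PSC n m} (h : K < L) : L.bos.card < K.bos.card := by
  -- The letter 1 keeps the alphabet nonempty when `m = n = 0`, as monotonicity of powers requires.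
  let S : Finset ℕ+ := insert 1 (univ.image (stdTheta m) ∪ univ.image K.stdWord)
  have ha : ∀ i, stdTheta m i ∈ S := fun i => by simp [S]
  have hlt : Fintype.card {b : Fin n → {c // c ∈ S} // L.InP (stdTheta m) fun j => b j} <
      Fintype.card {b : Fin n → {c // c ∈ S} // K.InP (stdTheta m) fun j => b j} := by
    have hmono : ∀ a b, L.InP a b → K.InP a b := by
      rw [lt_iff_le_and_ne, le_iff_succ] at h
      exact fun a b hb => ⟨fun i j hj => hb.1 i j (h.1.1 i j hj),
        fun i j hij => hb.2 i j (h.1.2 i j hij)⟩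
    rw [Fintype.card_subtype, Fintype.card_subtype]
    refine card_lt_card ((ssubset_iff_of_subset fun b => ?_).2
      ⟨fun j => ⟨K.stdWord j, by simp [S]⟩, ?_, ?_⟩)
    · simp only [mem_filter, mem_univ, true_and]
      exact hmono _ _
    · simp only [mem_filter, mem_univ, true_and]
      exact (K.stdWord_inM.inP_iff K).2 le_rfl
    · simp only [mem_filter, mem_univ, true_and]
      exact fun h' => h.not_ge ((K.stdWord_inM.inP_iff L).1 h')
  rw [card_inP _ S ha, card_inP _ S ha] at hlt
  by_contra! hle
  exact hlt.not_ge (Nat.pow_le_pow_right (card_pos.2 ⟨1, mem_insert_self _ _⟩) hle)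

lemma finer_eq_Icc (L : PSC n m) : L.finer = Icc (zeroHat n m L.df_le) L := by
  ext K
  simp [finer, zeroHat_le]

lemma sum_muZero (L : PSC n m) :
    ∑ K ∈ L.finer, K.muZero = if L = zeroHat n m L.df_le then 1 else 0 := by
  rw [finer_eq_Icc]
  exact (IncidenceAlgebra.sum_Icc_mu_right (𝕜 := ℚ) (zeroHat n m L.df_le) L).trans
    (if_congr eq_comm rfl rfl)

lemma filter_finer (L N : PSC n m) : L.finer.filter (· ≤ N) = (L ⊓ N).finer := by
  ext K
  simp [finer]

/-- Only `K ≤ L ⊓ N` contribute, and their Möbius values sum to 1 or 0 according to whether `L ⊓ N`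
is the least element. -/
lemma InM.sum_muZero_inP {N : PSC n m} {a : Fin m → ℕ+} {b : Fin n → ℕ+} (h : N.InM a b)
    (L : PSC n m) : ∑ K ∈ L.finer, K.muZero * (if K.InP a b then 1 else 0) =
      if L.InE a b then 1 else 0 := by
  simp only [h.inP_iff, h.inE_iff, mul_ite, mul_one, mul_zero]
  rw [← sum_filter, filter_finer, sum_muZero]

/-! ### Evaluation of the Möbius function by a polynomial identity -/

open Polynomial in
/-- `∏_{0 < j < k} (X - j)`. -/
def blockPoly (k : ℕ) : ℚ[X] := ∏ j ∈ range (k - 1), (X - C ((j : ℚ) + 1))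

lemma eval_blockPoly_natCast_succ (k y : ℕ) :
    (blockPoly k).eval ((y + 1 : ℕ) : ℚ) = y.descFactorial (k - 1) := by
  rw [blockPoly, Polynomial.eval_prod, ← descPochhammer_eval_eq_descFactorial,
    descPochhammer_eval_eq_prod_range]
  exact prod_congr rfl fun j _ => by simp

lemma eval_zero_blockPoly (k : ℕ) :
    (blockPoly k).eval 0 = (-1) ^ (k - 1) * (k - 1).factorial := by
  rw [blockPoly, Polynomial.eval_prod, ← prod_range_add_one_eq_factorial]
  push_cast
  rw [← card_range (k - 1), ← prod_const, card_range, ← prod_mul_distrib]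
  exact prod_congr rfl fun j _ => by simp

lemma eval_neg_one_blockPoly {k : ℕ} (hk : 0 < k) :
    (blockPoly k).eval (-1) = (-1) ^ (k - 1) * k.factorial := by
  obtain ⟨k, rfl⟩ := Nat.exists_eq_succ_of_ne_zero hk.ne'
  rw [blockPoly, Polynomial.eval_prod, ← prod_range_add_one_eq_factorial, prod_range_succ',
    Nat.succ_sub_one]
  push_cast
  rw [mul_one]
  nth_rw 2 [← card_range k]
  rw [← prod_const, ← prod_mul_distrib]
  exact prod_congr rfl fun j _ => by simp; ring

-- Evaluated at an alphabet size, both sides count the words of `E(L)` with θ-indices `1, …, m`: the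
-- right side directly by `card_inE`, the left by `InM.sum_muZero_inP` summed over all words.
open Polynomial in
lemma sum_muZero_X_pow (L : PSC n m) :
    ∑ K ∈ L.finer, C K.muZero * X ^ K.bos.card =
      X ^ L.bos.card * ((∏ i, blockPoly (L.fer i).card) * ∏ B ∈ L.bos, blockPoly B.card) := by
  -- The alphabet must contain `1, …, m`, and its size must be positive for
  -- `eval_blockPoly_natCast_succ`; hence the points `m + y + 1`.
  refine Polynomial.eq_of_infinite_eval_eq _ _ (Set.Infinite.mono
    (s := Set.range fun y : ℕ => ((m + y + 1 : ℕ) : ℚ)) ?_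
    (Set.infinite_range_of_injective fun x y h => by
      have := Nat.cast_injective h
      omega))
  rintro _ ⟨y, rfl⟩
  let S : Finset ℕ+ := (range (m + y + 1)).image Nat.succPNat
  have hS : S.card = m + y + 1 := by
    rw [card_image_of_injective _ Nat.succPNat_injective, card_range]
  have ha : ∀ i, stdTheta m i ∈ S := fun i =>
    mem_image_of_mem _ (mem_range.2 (by have := i.2; omega))
  have h1 : ∀ K : PSC n m, ((m + y + 1 : ℕ) : ℚ) ^ K.bos.card =
      ∑ b : Fin n → {c // c ∈ S}, if K.InP (stdTheta m) (fun j => b j) then 1 else 0 := by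
    intro K
    rw [sum_boole, ← Fintype.card_subtype, K.card_inP S ha, hS]
    push_cast
    rfl
  have h2 : ((∑ b : Fin n → {c // c ∈ S},
      if L.InE (stdTheta m) (fun j => b j) then 1 else 0 : ℚ)) =
      ((m + y + 1 : ℕ) : ℚ) ^ L.bos.card *
        ((∏ i, (blockPoly (L.fer i).card).eval ((m + y + 1 : ℕ) : ℚ)) *
          ∏ B ∈ L.bos, (blockPoly B.card).eval ((m + y + 1 : ℕ) : ℚ)) := by
    rw [sum_boole, ← Fintype.card_subtype, L.card_inE S ha, hS]
    simp only [eval_blockPoly_natCast_succ]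
    rw [mul_left_comm, ← prod_const, ← prod_mul_distrib]
    push_cast
    congr 1
    refine prod_congr rfl fun B hB => ?_
    obtain ⟨k, hk⟩ := Nat.exists_eq_succ_of_ne_zero (card_pos.2 (L.bos_nonempty B hB)).ne'
    rw [hk, Nat.succ_descFactorial_succ]
    push_cast
    rfl
  simp only [Set.mem_ofPred_eq, eval_finsetSum, eval_mul, eval_C, eval_pow, eval_X, eval_prod]
  rw [← h2]
  simp only [h1, mul_sum]
  rw [sum_comm]
  refine sum_congr rfl fun b _ => ?_
  obtain ⟨N, hN⟩ := exists_inM L.df_le (stdTheta_strictMono m).injective fun j => (b j : ℕ+)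
  exact hN.sum_muZero_inP L

/-- The product of `(|B| - 1)!` over all blocks `B` of `K`. -/
def cycleFactorial (K : PSC n m) : ℕ :=
  (∏ i, ((K.fer i).card - 1).factorial) * ∏ B ∈ K.bos, (B.card - 1).factorial

/-- Compare the coefficients of the lowest power, `X ^ L.bos.card`, in `sum_muZero_X_pow`. -/
lemma muZero_eq (L : PSC n m) : L.muZero = L.sign * L.cycleFactorial := by
  have h := congrArg (fun P => Polynomial.coeff P L.bos.card) (sum_muZero_X_pow L)
  simp only [Polynomial.finsetSum_coeff, Polynomial.coeff_C_mul, Polynomial.coeff_X_pow] at h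
  rw [sum_eq_single L] at h
  · rw [if_pos rfl, mul_one, Polynomial.coeff_X_pow_mul', if_pos le_rfl, Nat.sub_self,
      Polynomial.coeff_zero_eq_eval_zero, Polynomial.eval_mul, Polynomial.eval_prod,
      Polynomial.eval_prod] at h
    simp only [eval_zero_blockPoly, prod_mul_distrib] at h
    rw [h, sign, cycleFactorial]
    push_cast
    ring
  · intro K hK hKL
    -- Every `K` strictly below `L` has more nonfermionic blocks, hence contributes only to a higher
    -- power.
    rw [if_neg (card_bos_lt (lt_of_le_of_ne (mem_filter.1 hK).2 hKL)).ne, mul_zero]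
  · exact fun hL => (hL (mem_filter.2 ⟨mem_univ _, le_rfl⟩)).elim

lemma sign_eq_pow (K : PSC n m) :
    K.sign = (-1) ^ (∑ i, ((K.fer i).card - 1) + ∑ B ∈ K.bos, (B.card - 1)) := by
  rw [sign, pow_add, prod_pow_eq_pow_sum, prod_pow_eq_pow_sum]

lemma sign_mul_neg_one_pow (K : PSC n m) : K.sign * (-1) ^ K.bos.card = (-1) ^ n := by
  rw [sign_eq_pow, ← pow_add, add_assoc, card_eq_sum_ones, ← sum_add_distrib]
  congr 1
  refine Eq.trans ?_ K.card_add_sum_card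
  congr 1
  exact sum_congr rfl fun B hB => Nat.sub_add_cancel (card_pos.2 (K.bos_nonempty B hB))

lemma abs_sign (K : PSC n m) : |K.sign| = 1 := by
  rw [sign_eq_pow, abs_pow, abs_neg, abs_one, one_pow]

lemma sign_mul_self (K : PSC n m) : K.sign * K.sign = 1 := by
  rw [← abs_mul_abs_self, abs_sign, one_mul]

lemma abs_muZero (K : PSC n m) : |K.muZero| = K.cycleFactorial := by
  rw [muZero_eq, abs_mul, abs_sign, one_mul, Nat.abs_cast]

lemma muZero_eq_sign_mul_abs (K : PSC n m) : K.muZero = K.sign * |K.muZero| := by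
  rw [abs_muZero, muZero_eq]

lemma abs_muZero_eq_sign_mul (K : PSC n m) : |K.muZero| = K.sign * K.muZero := by
  rw [muZero_eq_sign_mul_abs K, ← mul_assoc, sign_mul_self, one_mul, abs_mul, abs_sign, one_mul,
    abs_abs]

lemma muZero_ne_zero (K : PSC n m) : K.muZero ≠ 0 := by
  rw [← abs_ne_zero, abs_muZero, cycleFactorial]
  exact Nat.cast_ne_zero.2 (mul_ne_zero (prod_ne_zero_iff.2 fun _ _ => Nat.factorial_ne_zero _)
    (prod_ne_zero_iff.2 fun _ _ => Nat.factorial_ne_zero _))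

/-- Put `X = -1` in `sum_muZero_X_pow`. On the left the signs of `μ(0̂, K)` and `(-1) ^ K.bos.card`
combine to `(-1) ^ n` for every `K`; on the right each block polynomial gives a signed factorial. -/
lemma sum_abs_muZero (L : PSC n m) : ∑ K ∈ L.finer, |K.muZero| = L.blockFactorial := by
  have h := congrArg (Polynomial.eval (-1)) (sum_muZero_X_pow L)
  simp only [Polynomial.eval_finsetSum, Polynomial.eval_mul, Polynomial.eval_C,
    Polynomial.eval_pow, Polynomial.eval_X, Polynomial.eval_prod] at h
  have h1 : ∀ K : PSC n m, K.muZero * (-1) ^ K.bos.card = (-1) ^ n * |K.muZero| := by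
    intro K
    rw [← K.sign_mul_neg_one_pow, K.muZero_eq_sign_mul_abs, abs_mul, abs_sign, abs_abs]
    ring
  have h2 : ∏ i, (blockPoly (L.fer i).card).eval (-1) =
      ∏ i, ((-1) ^ ((L.fer i).card - 1) * ((L.fer i).card.factorial : ℚ)) :=
    prod_congr rfl fun i _ => eval_neg_one_blockPoly (card_pos.2 ⟨0, L.zero_mem_fer i⟩)
  have h3 : ∏ B ∈ L.bos, (blockPoly B.card).eval (-1) =
      ∏ B ∈ L.bos, ((-1) ^ (B.card - 1) * (B.card.factorial : ℚ)) :=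
    prod_congr rfl fun B hB => eval_neg_one_blockPoly (card_pos.2 (L.bos_nonempty B hB))
  rw [sum_congr rfl fun K _ => h1 K, ← mul_sum, h2, h3, prod_mul_distrib, prod_mul_distrib,
    ← L.sign_mul_neg_one_pow] at h
  have h4 : L.sign * (-1) ^ L.bos.card ≠ 0 := by
    rw [sign_mul_neg_one_pow]
    exact pow_ne_zero _ (by norm_num)
  apply mul_left_cancel₀ h4
  rw [h, sign, blockFactorial]
  push_cast
  ring

end PSC

/-! ### Coefficients of symmetric functions in superspace -/

lemma thetaCoeff_orderEmbOfFin_comp {m : ℕ} {A : Finset ℕ+} (h : A.card = m)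
    (σ : Equiv.Perm (Fin m)) :
    thetaCoeff (fun i => A.orderEmbOfFin h (σ i)) A = ((Equiv.Perm.sign σ : ℤ) : ℚ) := by
  rw [thetaCoeff, dif_pos h, sum_eq_single σ]
  · rw [if_pos fun _ => rfl]
  · intro π _ hπ
    rw [if_neg]
    exact fun h' => hπ (Equiv.ext fun i => ((A.orderEmbOfFin h).injective (h' i)).symm)
  · exact fun h' => (h' (mem_univ _)).elim

lemma exists_eq_orderEmbOfFin_comp {m : ℕ} {a : Fin m → ℕ+} (ha : Function.Injective a)
    {A : Finset ℕ+} (hA : A.card = m) (h : ∀ i, a i ∈ A) :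
    ∃ σ : Equiv.Perm (Fin m), a = fun i => A.orderEmbOfFin hA (σ i) := by
  have hex : ∀ i, ∃ j, A.orderEmbOfFin hA j = a i := by
    intro i
    have : a i ∈ Set.range (A.orderEmbOfFin hA) := by
      rw [range_orderEmbOfFin]
      exact h i
    exact this
  choose t ht using hex
  have tinj : Function.Injective t := fun i j hij => ha (by rw [← ht, ← ht, hij])
  exact ⟨Equiv.ofBijective t (Finite.injective_iff_bijective.1 tinj), funext fun i => (ht i).symm⟩

lemma thetaCoeff_mul_self {m : ℕ} {a : Fin m → ℕ+} (ha : Function.Injective a)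
    {A : Finset ℕ+} (hA : A.card = m) (h : ∀ i, a i ∈ A) :
    thetaCoeff a A * thetaCoeff a A = 1 := by
  obtain ⟨σ, rfl⟩ := exists_eq_orderEmbOfFin_comp ha hA h
  rw [thetaCoeff_orderEmbOfFin_comp]
  rcases Int.units_eq_one_or (Equiv.Perm.sign σ) with h | h <;> simp [h]

lemma thetaCoeff_comp_perm {m : ℕ} (a : Fin m → ℕ+) (A : Finset ℕ+) (σ : Equiv.Perm (Fin m)) :
    thetaCoeff (fun i => a (σ i)) A = ((Equiv.Perm.sign σ : ℤ) : ℚ) * thetaCoeff a A := by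
  unfold thetaCoeff
  split_ifs with h
  · rw [mul_sum]
    refine (Fintype.sum_equiv (Equiv.mulRight σ) _ _ fun π => ?_).symm
    have : (∀ i, a (σ i) = A.orderEmbOfFin h ((Equiv.mulRight σ π) i)) ↔
        ∀ i, a i = A.orderEmbOfFin h (π i) :=
      ⟨fun h' i => by simpa using h' (σ.symm i), fun h' i => h' (σ i)⟩
    simp only [this]
    split_ifs
    · simp [mul_comm]
    · simp
  · rw [mul_zero]

lemma formalSum_apply {n m : ℕ} (c : (Fin m → ℕ+) → (Fin n → ℕ+) → ℚ) {A : Finset ℕ+}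
    (hA : A.card = m) (b : Fin n → ℕ+) :
    formalSum c (A, List.ofFn b) = ∑ σ : Equiv.Perm (Fin m),
      ((Equiv.Perm.sign σ : ℤ) : ℚ) * c (fun i => A.orderEmbOfFin hA (σ i)) b := by
  rw [formalSum_eq_sum, sum_product_right, sum_eq_single b]
  · simp only [monomialCoeff, if_true, thetaCoeff, dif_pos hA, mul_sum]
    rw [sum_comm]
    refine sum_congr rfl fun σ _ => ?_
    rw [sum_eq_single fun i => A.orderEmbOfFin hA (σ i)]
    · rw [if_pos fun _ => rfl, mul_comm]
    · intro a _ ha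
      rw [if_neg fun h => ha (funext h), mul_zero]
    · intro h
      exact (h (Fintype.mem_piFinset.2 fun i => orderEmbOfFin_mem _ _ _)).elim
  · intro b' _ hb
    refine sum_eq_zero fun a _ => ?_
    rw [monomialCoeff, if_neg fun h => hb (List.ofFn_injective h), mul_zero]
  · intro h
    exact (h (Fintype.mem_piFinset.2 fun i => by simp)).elim

lemma formalSum_eq_zero {n m : ℕ} (c : (Fin m → ℕ+) → (Fin n → ℕ+) → ℚ) {u : SMonomial}
    (hu : ¬ (u.1.card = m ∧ u.2.length = n)) : formalSum c u = 0 := by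
  rw [formalSum_eq_sum]
  refine sum_eq_zero fun ab _ => ?_
  rw [monomialCoeff]
  split_ifs with h
  · rw [thetaCoeff, dif_neg, mul_zero]
    exact fun h' => hu ⟨h', by rw [← h, List.length_ofFn]⟩
  · rw [mul_zero]

lemma exists_eq_ofFn {α : Type*} {n : ℕ} {w : List α} (h : w.length = n) :
    ∃ b : Fin n → α, w = List.ofFn b := by
  subst h
  exact ⟨w.get, (List.ofFn_get w).symm⟩

/-- This is invariance for monomials whose θ's are not in increasing order; the `thetaCoeff` factors
account for the sorting signs. -/
lemma sNCSym_apply_perm {f : SMonomial → ℚ} (hf : f ∈ sNCSym) {N : ℕ+} {s : Equiv.Perm ℕ+}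
    (hs : ∀ i, N < i → s i = i) {n m : ℕ} (a : Fin m → ℕ+)
    (b : Fin n → ℕ+) :
    thetaCoeff (fun i => s (a i)) (univ.image fun i => s (a i)) *
        f (univ.image fun i => s (a i), List.ofFn fun j => s (b j)) =
      thetaCoeff a (univ.image a) * f (univ.image a, List.ofFn b) := by
  set A := univ.image fun i => s (a i) with hAdef
  have hB : univ.image a = A.image s.symm := by
    rw [hAdef, image_image]
    congr 1
    ext i
    simp
  have hbc : (List.ofFn fun j => s (b j)).map s.symm = List.ofFn b := by
    rw [List.map_ofFn]
    congr 1
    ext j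
    simp
  have h1 := thetaCoeff_perm s a A _ rfl
  rw [← hB] at h1
  have h2 := congrFun (hf.2 N s hs) (A, List.ofFn fun j => s (b j))
  change thetaCoeff (fun i => s ((A.image s.symm).orderEmbOfFin rfl i)) A *
    f (A.image s.symm, (List.ofFn fun j => s (b j)).map s.symm) = _ at h2
  rw [← hB, hbc] at h2
  rw [← h2, ← h1]
  have h3 : thetaCoeff (fun i => s ((univ.image a).orderEmbOfFin rfl i)) A *
      thetaCoeff (fun i => s ((univ.image a).orderEmbOfFin rfl i)) A = 1 := by
    refine thetaCoeff_mul_self (s.injective.comp (orderEmbOfFin _ _).injective) ?_ fun i => ?_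
    · rw [hB, card_image_of_injective _ s.symm.injective]
    · have h4 : (univ.image a).orderEmbOfFin rfl i ∈ A.image s.symm :=
        hB ▸ orderEmbOfFin_mem _ _ _
      obtain ⟨x, hx, h5⟩ := mem_image.1 h4
      simpa [← h5] using hx
  linear_combination
    (thetaCoeff a (univ.image a) * f (univ.image a, List.ofFn b)) * h3

/-- Swapping two θ-indices that do not occur in `b` fixes the word and negates the θ-product, so
invariance forces the coefficient to equal its negative. -/
lemma sNCSym_apply_eq_zero {f : SMonomial → ℚ} (hf : f ∈ sNCSym) {n m : ℕ} {a : Fin m → ℕ+}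
    (ha : Function.Injective a) {b : Fin n → ℕ+} (h : NullSymmetric a b) :
    f (univ.image a, List.ofFn b) = 0 := by
  obtain ⟨x, hx, y, hy, hxy⟩ := one_lt_card.1 h
  obtain ⟨hx1, hx2⟩ := mem_sdiff.1 hx
  obtain ⟨hy1, hy2⟩ := mem_sdiff.1 hy
  obtain ⟨i, -, rfl⟩ := mem_image.1 hx1
  obtain ⟨k, -, rfl⟩ := mem_image.1 hy1
  have hik : i ≠ k := fun h => hxy (by rw [h])
  have key := sNCSym_apply_perm hf (N := max (a i) (a k)) (s := Equiv.swap (a i) (a k))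
    (fun z hz => Equiv.swap_apply_of_ne_of_ne ((le_max_left _ _).trans_lt hz).ne'
      ((le_max_right _ _).trans_lt hz).ne') a b
  have h1 : (fun l => Equiv.swap (a i) (a k) (a l)) = fun l => a (Equiv.swap i k l) := by
    ext l
    rw [ha.map_swap]
  have h2 : (fun j => Equiv.swap (a i) (a k) (b j)) = b := by
    ext j
    rw [Equiv.swap_apply_of_ne_of_ne]
    · exact fun h => hx2 (h ▸ mem_image_of_mem _ (mem_univ _))
    · exact fun h => hy2 (h ▸ mem_image_of_mem _ (mem_univ _))
  have h3 : (univ.image fun l => a (Equiv.swap i k l)) = univ.image a := by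
    ext x
    simp only [mem_image, mem_univ, true_and]
    exact (Equiv.swap i k).exists_congr_left.trans (by simp)
  rw [h1, h2, h3, thetaCoeff_comp_perm, Equiv.Perm.sign_swap hik] at key
  have h4 := thetaCoeff_mul_self ha (card_image_of_injective _ ha |>.trans (by simp))
    fun i => mem_image_of_mem a (mem_univ i)
  push_cast at key
  linear_combination (- thetaCoeff a (univ.image a) / 2) * key -
    f (univ.image a, List.ofFn b) * h4

lemma image_orderEmbOfFin_comp {m : ℕ} {A : Finset ℕ+} (hA : A.card = m)
    (σ : Equiv.Perm (Fin m)) : (univ.image fun i => A.orderEmbOfFin hA (σ i)) = A := by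
  have : (fun i => A.orderEmbOfFin hA (σ i)) = A.orderEmbOfFin hA ∘ σ := rfl
  rw [this, ← image_image, image_univ_equiv, image_orderEmbOfFin_univ]

/-- The coefficient functions may differ at repeated or null-symmetric θ-indices: the former never
contribute, and at the latter both series vanish because they lie in `sNCSym`. -/
lemma formalSum_congr {n m : ℕ} {c c' : (Fin m → ℕ+) → (Fin n → ℕ+) → ℚ}
    (hc : formalSum c ∈ sNCSym) (hc' : formalSum c' ∈ sNCSym)
    (h : ∀ a b, Function.Injective a → ¬ NullSymmetric a b → c a b = c' a b) :
    formalSum c = formalSum c' := by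
  ext ⟨A, w⟩
  by_cases hu : A.card = m ∧ w.length = n
  swap
  · rw [formalSum_eq_zero c hu, formalSum_eq_zero c' hu]
  obtain ⟨hA, hw⟩ := hu
  obtain ⟨b, rfl⟩ := exists_eq_ofFn hw
  have hinj : ∀ σ : Equiv.Perm (Fin m), Function.Injective fun i => A.orderEmbOfFin hA (σ i) :=
    fun σ => (A.orderEmbOfFin hA).injective.comp σ.injective
  by_cases hnull : ∃ σ : Equiv.Perm (Fin m), NullSymmetric (fun i => A.orderEmbOfFin hA (σ i)) b
  · obtain ⟨σ, hσ⟩ := hnull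
    have h1 := sNCSym_apply_eq_zero hc (hinj σ) hσ
    have h2 := sNCSym_apply_eq_zero hc' (hinj σ) hσ
    rw [image_orderEmbOfFin_comp] at h1 h2
    rw [h1, h2]
  · push Not at hnull
    rw [formalSum_apply c hA, formalSum_apply c' hA]
    exact sum_congr rfl fun σ _ => by rw [h _ _ (hinj σ) (hnull σ)]

/-- At most one of the `m` distinct θ-indices is missing from the at most `n` letters of `b`. This
is why the bound `m ≤ n + 1` on bidegrees loses nothing. -/
lemma le_succ_of_not_nullSymmetric {n m : ℕ} {a : Fin m → ℕ+} {b : Fin n → ℕ+}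
    (ha : Function.Injective a) (h : ¬ NullSymmetric a b) : m ≤ n + 1 := by
  have h1 : (univ.image a).card = m := by rw [card_image_of_injective _ ha]; simp
  have h2 : (univ.image b).card ≤ n := card_image_le.trans (by simp)
  have h3 := le_card_sdiff (univ.image b) (univ.image a)
  rw [NullSymmetric] at h
  omega

/-- The linear combination of formal sums. -/
lemma sum_smul_formalSum {n m : ℕ} {ι : Type*} (s : Finset ι) (r : ι → ℚ)
    (c : ι → (Fin m → ℕ+) → (Fin n → ℕ+) → ℚ) :
    ∑ i ∈ s, r i • formalSum (c i) = formalSum fun a b => ∑ i ∈ s, r i * c i a b := by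
  ext u
  simp only [Finset.sum_apply, Pi.smul_apply, smul_eq_mul, formalSum_eq_sum, mul_sum, sum_mul]
  rw [sum_comm]
  simp only [mul_assoc]

/-- Two linear combinations of functions in `sNCSym` agree if their coefficients agree at the
monomials which are neither zero nor null-symmetric. -/
lemma sum_smul_congr {n m : ℕ} {ι κ : Type*} {s : Finset ι} {r : ι → ℚ} {t : Finset κ} {q : κ → ℚ}
    {c : ι → (Fin m → ℕ+) → (Fin n → ℕ+) → ℚ} {d : κ → (Fin m → ℕ+) → (Fin n → ℕ+) → ℚ}
    {F : ι → sNCSym} {G : κ → sNCSym} (hF : ∀ i, (F i : SMonomial → ℚ) = formalSum (c i))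
    (hG : ∀ i, (G i : SMonomial → ℚ) = formalSum (d i))
    (h : ∀ (N : PSC n m) a b, N.InM a b → Function.Injective a → ¬ NullSymmetric a b →
      ∑ i ∈ s, r i * c i a b = ∑ i ∈ t, q i * d i a b) :
    ∑ i ∈ s, r i • F i = ∑ i ∈ t, q i • G i := by
  have h1 : ((∑ i ∈ s, r i • F i : sNCSym) : SMonomial → ℚ) =
      formalSum fun a b => ∑ i ∈ s, r i * c i a b := by
    rw [← sum_smul_formalSum]
    simp [hF]
  have h2 : ((∑ i ∈ t, q i • G i : sNCSym) : SMonomial → ℚ) =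
      formalSum fun a b => ∑ i ∈ t, q i * d i a b := by
    rw [← sum_smul_formalSum]
    simp [hG]
  apply Subtype.ext
  rw [h1, h2]
  refine formalSum_congr (h1 ▸ Subtype.prop _) (h2 ▸ Subtype.prop _) fun a b ha hab => ?_
  obtain ⟨N, hN⟩ := PSC.exists_inM (le_succ_of_not_nullSymmetric ha hab) ha b
  exact h N a b hN ha hab

namespace PSC

variable {n m : ℕ} {V : Type*} [AddCommGroup V] [Module ℚ V]

/-! ### Möbius inversion -/

/-- The finite set of all `L` with `K ⊑ L`. -/
def coarser (K : PSC n m) : Finset (PSC n m) := univ.filter fun L => K ≤ L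

lemma mem_finer {K L : PSC n m} : K ∈ L.finer ↔ K ≤ L := by simp [finer]

lemma mem_coarser {K L : PSC n m} : L ∈ K.coarser ↔ K ≤ L := by simp [coarser]

lemma sum_Icc_mu_left (K L : PSC n m) : ∑ N ∈ Icc K L, mu N L = if K = L then 1 else 0 :=
  IncidenceAlgebra.sum_Icc_mu_left (𝕜 := ℚ) K L

lemma sum_Icc_mu_right (K L : PSC n m) : ∑ N ∈ Icc K L, mu K N = if K = L then 1 else 0 :=
  IncidenceAlgebra.sum_Icc_mu_right (𝕜 := ℚ) K L

lemma eq_sum_finer_mu_smul {f g : PSC n m → V} (h : ∀ I, g I = ∑ K ∈ I.finer, f K)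
    (I : PSC n m) : f I = ∑ K ∈ I.finer, mu K I • g K := by
  simp only [h, smul_sum]
  rw [sum_comm' (t' := I.finer) (s' := fun L => Icc L I) fun K L => by
    simp only [mem_finer, mem_Icc]
    exact ⟨fun h => ⟨⟨h.2, h.1⟩, h.2.trans h.1⟩, fun h => ⟨h.1.2, h.1.1⟩⟩]
  simp only [← sum_smul, sum_Icc_mu_left, ite_smul, one_smul, zero_smul]
  rw [sum_ite_eq', if_pos (mem_finer.2 le_rfl)]

lemma eq_sum_coarser_mu_smul {f g : PSC n m → V} (h : ∀ I, g I = ∑ K ∈ I.coarser, f K)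
    (I : PSC n m) : f I = ∑ K ∈ I.coarser, mu I K • g K := by
  simp only [h, smul_sum]
  rw [sum_comm' (t' := I.coarser) (s' := fun L => Icc I L) fun K L => by
    simp only [mem_coarser, mem_Icc]
    exact ⟨fun h => ⟨⟨h.1, h.2⟩, h.1.trans h.2⟩, fun h => ⟨h.1.1, h.1.2⟩⟩]
  simp only [← sum_smul, sum_Icc_mu_right, ite_smul, one_smul, zero_smul]
  rw [sum_ite_eq, if_pos (mem_coarser.2 le_rfl)]

lemma sum_coarser_sum_mu_smul (g : PSC n m → V) (I : PSC n m) :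
    ∑ K ∈ I.coarser, ∑ L ∈ K.coarser, mu K L • g L = g I := by
  rw [sum_comm' (t' := I.coarser) (s' := fun L => Icc I L) fun K L => by
    simp only [mem_coarser, mem_Icc]
    exact ⟨fun h => ⟨⟨h.1, h.2⟩, h.1.trans h.2⟩, fun h => ⟨h.1.1, h.1.2⟩⟩]
  simp only [← sum_smul, sum_Icc_mu_left, ite_smul, one_smul, zero_smul]
  rw [sum_ite_eq, if_pos (mem_coarser.2 le_rfl)]

end PSC

/-! ### Relations between the functions -/

section Relations

variable {n m : ℕ}

/-- The monomial function `m_K`, the sum of all monomials of type `K`. -/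
def mFun (K : PSC n m) : sNCSym :=
  ⟨formalSum fun a b => if K.InM a b then 1 else 0,
    formalSum_mem_sNCSym _ fun s a b => if_congr (PSC.inM_perm K s a b) rfl rfl⟩

lemma hCoeff_eq {N : PSC n m} {a : Fin m → ℕ+} {b : Fin n → ℕ+} (h : N.InM a b)
    (hab : ¬ NullSymmetric a b) (K : PSC n m) : hCoeff K a b = (K ⊓ N).blockFactorial := by
  rw [hCoeff, if_neg hab]
  have : univ.filter (fun L : PSC n m => L.InM a b) = {N} := by
    ext L
    simp only [mem_filter, mem_univ, true_and, mem_singleton]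
    exact ⟨fun hL => hL.unique h, fun hL => hL ▸ h⟩
  rw [this, sum_singleton]

lemma eFun_eq_sum_pFun (I : PSC n m) : eFun I = ∑ K ∈ I.finer, K.muZero • pFun K := by
  have h := sum_smul_congr (s := {()}) (r := 1) (t := I.finer) (q := PSC.muZero)
    (c := fun _ a b => if I.InE a b then 1 else 0) (d := fun K a b => if K.InP a b then 1 else 0)
    (F := fun _ => eFun I) (G := pFun) (fun _ => rfl) (fun _ => rfl)
    fun N a b hN _ _ => by simpa using (hN.sum_muZero_inP I).symm
  simpa using h

/-- At a monomial of type `N` this is `sum_abs_muZero` for `I ⊓ N`. -/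
lemma hFun_eq_sum_pFun (I : PSC n m) : hFun I = ∑ K ∈ I.finer, |K.muZero| • pFun K := by
  have h := sum_smul_congr (s := {()}) (r := 1) (t := I.finer) (q := fun K => |K.muZero|)
    (c := fun _ => hCoeff I) (d := fun K a b => if K.InP a b then 1 else 0)
    (F := fun _ => hFun I) (G := pFun) (fun _ => rfl) (fun _ => rfl)
    fun N a b hN _ hab => by
      rw [sum_singleton, Pi.one_apply, one_mul, hCoeff_eq hN hab]
      simp only [hN.inP_iff, mul_ite, mul_one, mul_zero]
      rw [← sum_filter, PSC.filter_finer, PSC.sum_abs_muZero]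
  simpa using h

lemma pFun_eq_sum_mFun (I : PSC n m) : pFun I = ∑ K ∈ I.coarser, mFun K := by
  have h := sum_smul_congr (s := {()}) (r := 1) (t := I.coarser) (q := 1)
    (c := fun _ a b => if I.InP a b then 1 else 0) (d := fun K a b => if K.InM a b then 1 else 0)
    (F := fun _ => pFun I) (G := mFun) (fun _ => rfl) (fun _ => rfl)
    fun N a b hN _ _ => by
      have : ∀ K : PSC n m, K.InM a b ↔ K = N :=
        fun K => ⟨fun hK => hK.unique hN, fun hK => hK ▸ hN⟩
      simp [this, hN.inP_iff, PSC.mem_coarser]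
  simpa using h

lemma mFun_eq_sum_pFun (I : PSC n m) : mFun I = ∑ K ∈ I.coarser, PSC.mu I K • pFun K :=
  PSC.eq_sum_coarser_mu_smul pFun_eq_sum_mFun I

lemma pFun_eq_sum_eFun (I : PSC n m) :
    pFun I = (1 / I.muZero) • ∑ K ∈ I.finer, PSC.mu K I • eFun K := by
  rw [← PSC.eq_sum_finer_mu_smul (f := fun K => K.muZero • pFun K) eFun_eq_sum_pFun I, smul_smul,
    one_div, inv_mul_cancel₀ I.muZero_ne_zero, one_smul]

lemma pFun_eq_sum_hFun (I : PSC n m) :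
    pFun I = (1 / |I.muZero|) • ∑ K ∈ I.finer, PSC.mu K I • hFun K := by
  rw [← PSC.eq_sum_finer_mu_smul (f := fun K => |K.muZero| • pFun K) hFun_eq_sum_pFun I, smul_smul,
    one_div, inv_mul_cancel₀ (abs_ne_zero.2 I.muZero_ne_zero), one_smul]

/-- By Möbius inversion the inner sum is `|μ(0̂, K)| p_K`, and the sign turns it into `μ(0̂, K)
p_K`. -/
lemma eFun_eq_sum_hFun (I : PSC n m) :
    eFun I = ∑ K ∈ I.finer, K.sign • ∑ L ∈ K.finer, PSC.mu L K • hFun L := by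
  simp only [← PSC.eq_sum_finer_mu_smul (f := fun K => |K.muZero| • pFun K) hFun_eq_sum_pFun,
    smul_smul, ← PSC.muZero_eq_sign_mul_abs]
  exact eFun_eq_sum_pFun I

lemma hFun_eq_sum_eFun (I : PSC n m) :
    hFun I = ∑ K ∈ I.finer, K.sign • ∑ L ∈ K.finer, PSC.mu L K • eFun L := by
  simp only [← PSC.eq_sum_finer_mu_smul (f := fun K => K.muZero • pFun K) eFun_eq_sum_pFun,
    smul_smul, ← PSC.abs_muZero_eq_sign_mul]
  exact hFun_eq_sum_pFun I

end Relations

/-! ### Permutations of the fermionic blocks -/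

namespace PSC

variable {n m : ℕ}

/-- Permute the fermionic blocks. -/
def act (K : PSC n m) (σ : Equiv.Perm (Fin m)) : PSC n m where
  fer i := K.fer (σ i)
  bos := K.bos
  df_le := K.df_le
  zero_mem_fer i := K.zero_mem_fer _
  zero_notMem_bos := K.zero_notMem_bos
  bos_nonempty := K.bos_nonempty
  fer_inter_fer i j h := K.fer_inter_fer _ _ fun h' => h (σ.injective h')
  fer_disjoint_bos i := K.fer_disjoint_bos _
  bos_disjoint := K.bos_disjoint
  cover j hj := (K.cover j hj).imp_left fun ⟨i, hi⟩ => ⟨σ.symm i, by simpa using hi⟩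

lemma act_act (K : PSC n m) (σ τ : Equiv.Perm (Fin m)) : (K.act σ).act τ = K.act (σ * τ) := rfl

lemma act_one (K : PSC n m) : K.act 1 = K := rfl

/-- Permuting the fermionic blocks is a bijection of `PSC n m`. -/
def actEquiv (σ : Equiv.Perm (Fin m)) : PSC n m ≃ PSC n m where
  toFun K := K.act σ
  invFun K := K.act σ⁻¹
  left_inv K := by simp only [act_act, mul_inv_cancel, act_one]
  right_inv K := by simp only [act_act, inv_mul_cancel, act_one]

lemma act_sameBlock (K : PSC n m) (σ : Equiv.Perm (Fin m)) (j k : Fin (n + 1)) :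
    (K.act σ).SameBlock j k ↔ K.SameBlock j k :=
  or_congr (σ.exists_congr_left.trans (by simp [act])) Iff.rfl

lemma act_le_act {K L : PSC n m} (σ : Equiv.Perm (Fin m)) : K.act σ ≤ L.act σ ↔ K ≤ L := by
  simp only [le_iff_succ, act_sameBlock]
  exact and_congr ⟨fun h i => by simpa [act] using h (σ.symm i), fun h i => h (σ i)⟩ Iff.rfl

lemma sign_act (K : PSC n m) (σ : Equiv.Perm (Fin m)) : (K.act σ).sign = K.sign :=
  congrArg (· * _) (Equiv.prod_comp σ fun i => (-1 : ℚ) ^ ((K.fer i).card - 1))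

variable (K : PSC n m) (σ : Equiv.Perm (Fin m)) (a : Fin m → ℕ+) (b : Fin n → ℕ+)

lemma act_inM : (K.act σ).InM (fun i => a (σ i)) b ↔ K.InM a b := by
  simp only [InM, act_sameBlock]
  exact and_congr ⟨fun h i => by simpa [act] using h (σ.symm i), fun h i => h (σ i)⟩ Iff.rfl

lemma act_inP : (K.act σ).InP (fun i => a (σ i)) b ↔ K.InP a b := by
  simp only [InP, act_sameBlock]
  exact and_congr ⟨fun h i => by simpa [act] using h (σ.symm i), fun h i => h (σ i)⟩ Iff.rfl

lemma act_inE : (K.act σ).InE (fun i => a (σ i)) b ↔ K.InE a b := by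
  simp only [InE, act_sameBlock]
  exact and_congr ⟨fun h i => by simpa [act] using h (σ.symm i), fun h i => h (σ i)⟩ Iff.rfl

end PSC

/-! ### Sign change of power sums and elementary functions under block permutations -/

section Antisymmetry

variable {n m : ℕ} (K : PSC n m) (σ : Equiv.Perm (Fin m))

/-- Reindexing the θ's by `σ` multiplies their product by the sign of `σ`. -/
lemma formalSum_comp_perm {c c' : (Fin m → ℕ+) → (Fin n → ℕ+) → ℚ}
    (h : ∀ a b, c' (fun i => a (σ i)) b = c a b) :
    formalSum c' = ((Equiv.Perm.sign σ : ℤ) : ℚ) • formalSum c := by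
  ext ⟨A, w⟩
  rw [Pi.smul_apply]
  by_cases hu : A.card = m ∧ w.length = n
  swap
  · rw [formalSum_eq_zero c hu, formalSum_eq_zero c' hu, smul_zero]
  obtain ⟨hA, hw⟩ := hu
  obtain ⟨b, rfl⟩ := exists_eq_ofFn hw
  rw [formalSum_apply c hA, formalSum_apply c' hA, smul_eq_mul, mul_sum]
  refine (Fintype.sum_equiv (Equiv.mulRight σ) _ _ fun π => ?_).symm
  have := h (fun i => A.orderEmbOfFin hA (π i)) b
  simp only [Equiv.coe_mulRight, Equiv.Perm.coe_mul, Function.comp_apply, this,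
    Equiv.Perm.sign_mul, Units.val_mul, Int.cast_mul]
  ring

lemma pFun_act : pFun (K.act σ) = ((Equiv.Perm.sign σ : ℤ) : ℚ) • pFun K :=
  Subtype.ext (formalSum_comp_perm (c := fun a b => if K.InP a b then 1 else 0)
    (c' := fun a b => if (K.act σ).InP a b then 1 else 0) σ
    fun a b => if_congr (K.act_inP σ a b) rfl rfl)

lemma eFun_act : eFun (K.act σ) = ((Equiv.Perm.sign σ : ℤ) : ℚ) • eFun K :=
  Subtype.ext (formalSum_comp_perm (c := fun a b => if K.InE a b then 1 else 0)
    (c' := fun a b => if (K.act σ).InE a b then 1 else 0) σ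
    fun a b => if_congr (K.act_inE σ a b) rfl rfl)

end Antisymmetry

namespace PSC

variable {n m : ℕ}

/-- Distinct fermionic blocks can be sorted into those of a set superpartition. -/
lemma exists_isSetSuperpartition_act (K : PSC n m) (hK : Function.Injective K.fer) :
    ∃ σ, (K.act σ).IsSetSuperpartition := by
  -- The block `{0}` gets the default key 0; it occurs at most once since the fermionic blocks are
  -- distinct.
  let key : Fin m → Fin (n + 1) := fun i => minOrZero ((K.fer i).erase 0)
  have hmem : ∀ i, ((K.fer i).erase 0).Nonempty → key i ∈ (K.fer i).erase 0 := by
    intro i h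
    simp only [key, minOrZero, dif_pos h]
    exact min'_mem _ _
  have hemp : ∀ i, ¬ ((K.fer i).erase 0).Nonempty → key i = 0 := by
    intro i h
    simp only [key, minOrZero, dif_neg h]
  have hinj : Function.Injective key := by
    intro i j hij
    by_cases hi : ((K.fer i).erase 0).Nonempty
    · have h1 := mem_erase.1 (hmem i hi)
      by_cases hj : ((K.fer j).erase 0).Nonempty
      · exact K.fer_unique h1.1 h1.2 (hij ▸ (mem_erase.1 (hmem j hj)).2)
      · exact (h1.1 (hij.trans (hemp j hj))).elim
    · by_cases hj : ((K.fer j).erase 0).Nonempty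
      · exact ((mem_erase.1 (hmem j hj)).1 (hij.symm.trans (hemp i hi))).elim
      · apply hK
        rw [not_nonempty_iff_eq_empty] at hi hj
        rw [← insert_erase (K.zero_mem_fer i), ← insert_erase (K.zero_mem_fer j), hi, hj]
  refine ⟨Tuple.sort key, fun i j hij => ?_⟩
  have hmono : StrictMono (key ∘ Tuple.sort key) :=
    (Tuple.monotone_sort key).strictMono_of_injective (hinj.comp (Tuple.sort key).injective)
  -- As two fermionic blocks share only 0, the pairwise condition on set superpartitions compares
  -- keys of single blocks, so sorting by `key` achieves it.
  have hsdiff : ∀ i j, i ≠ j → K.fer i \ K.fer j = (K.fer i).erase 0 := by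
    intro i j hij
    ext x
    rw [mem_sdiff, mem_erase, and_comm]
    refine and_congr_left fun hx => ⟨fun h h0 => h (h0 ▸ K.zero_mem_fer j), fun h0 h => ?_⟩
    exact hij (K.fer_unique h0 hx h)
  have hne : Tuple.sort key i ≠ Tuple.sort key j := fun h => hij.ne ((Tuple.sort key).injective h)
  refine ⟨fun h => hne (hK h), ?_⟩
  change minOrZero (K.fer _ \ K.fer _) < minOrZero (K.fer _ \ K.fer _)
  rw [hsdiff _ _ hne, hsdiff _ _ hne.symm]
  exact hmono hij

end PSC

/-- An alternating family is determined by its values at set superpartitions. -/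
lemma eq_of_eq_on_setSuperpartition {n m : ℕ} {V : Type*} [AddCommGroup V] [Module ℚ V]
    {f g : PSC n m → V}
    (hf : ∀ K σ, f (K.act σ) = ((Equiv.Perm.sign σ : ℤ) : ℚ) • f K)
    (hg : ∀ K σ, g (K.act σ) = ((Equiv.Perm.sign σ : ℤ) : ℚ) • g K)
    (h : ∀ I : SetSuperpartition n m, f I.1 = g I.1) (K : PSC n m) : f K = g K := by
  by_cases hK : Function.Injective K.fer
  · obtain ⟨σ, hσ⟩ := K.exists_isSetSuperpartition_act hK
    have h1 := h ⟨_, hσ⟩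
    simp only [hf, hg] at h1
    have h2 : ((Equiv.Perm.sign σ : ℤ) : ℚ) ≠ 0 := by simp
    exact smul_right_injective V h2 h1
  · simp only [Function.Injective, not_forall] at hK
    obtain ⟨i, j, hij, hne⟩ := hK
    -- Exchanging two equal blocks fixes `K` but has sign -1, so an alternating family vanishes at
    -- `K`.
    have hact : K.act (Equiv.swap i j) = K := by
      refine PSC.ext (funext fun k => ?_) rfl
      change K.fer (Equiv.swap i j k) = K.fer k
      by_cases hki : k = i
      · rw [hki, Equiv.swap_apply_left, hij]
      · by_cases hkj : k = j
        · rw [hkj, Equiv.swap_apply_right, hij]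
        · rw [Equiv.swap_apply_of_ne_of_ne hki hkj]
    have hzero : ∀ f : PSC n m → V,
        (∀ K σ, f (K.act σ) = ((Equiv.Perm.sign σ : ℤ) : ℚ) • f K) → f K = 0 := by
      intro f hf
      have h1 := hf K (Equiv.swap i j)
      rw [hact, Equiv.Perm.sign_swap hne] at h1
      have h2 : (2 : ℚ) • f K = 0 := by
        rw [two_smul]
        nth_rw 1 [h1]
        simp
      exact (smul_eq_zero.1 h2).resolve_left (by norm_num)
    rw [hzero f hf, hzero g hg]

/-! ### The expansion of a symmetric function in superspace -/

/-- The two families have the same coincidences, so `g x ↦ g' x` is a partial injection of the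
finite set of indices up to `N` and extends to a permutation of that set. -/
lemma exists_perm_extending {ι : Type*} [Fintype ι] {g g' : ι → ℕ+}
    (h : ∀ x y, g x = g y ↔ g' x = g' y) :
    ∃ (N : ℕ+) (s : Equiv.Perm ℕ+), (∀ i, N < i → s i = i) ∧ ∀ x, s (g x) = g' x := by
  let N : ℕ+ := univ.sup g ⊔ univ.sup g'
  have hg : ∀ x, g x ≤ N := fun x => (le_sup (mem_univ x)).trans le_sup_left
  have hg' : ∀ x, g' x ≤ N := fun x => (le_sup (mem_univ x)).trans le_sup_right
  obtain ⟨s, hs⟩ := Equiv.Perm.exists_extending_pair (α := Set.range g) (β := {i // i ≤ N})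
    (fun y => ⟨y, by obtain ⟨x, hx⟩ := y.2; exact hx ▸ hg x⟩)
    (fun y => ⟨g' y.2.choose, hg' _⟩)
    (fun y z hyz => Subtype.ext (Subtype.mk.inj hyz)) fun y z hyz => by
      have h1 := (h _ _).2 (Subtype.mk.inj hyz)
      rw [y.2.choose_spec, z.2.choose_spec] at h1
      exact Subtype.ext h1
  refine ⟨N, Equiv.Perm.ofSubtype s, fun i hi => ?_, fun x => ?_⟩
  · exact Equiv.Perm.ofSubtype_apply_of_not_mem s (not_le.2 hi)
  · have h1 := hs ⟨g x, x, rfl⟩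
    rw [Equiv.Perm.ofSubtype_apply_of_mem s (hg x), h1]
    exact (h _ _).1 (Exists.choose_spec (p := fun y => g y = g x) ⟨x, rfl⟩)

section Expansion

variable {n m : ℕ}

lemma card_image_stdTheta (m : ℕ) : (univ.image (PSC.stdTheta m)).card = m := by
  rw [card_image_of_injective _ (PSC.stdTheta_strictMono m).injective, card_univ, Fintype.card_fin]

lemma stdTheta_eq_orderEmbOfFin (m : ℕ) :
    PSC.stdTheta m = (univ.image (PSC.stdTheta m)).orderEmbOfFin (card_image_stdTheta m) :=
  orderEmbOfFin_unique _ (fun i => mem_image_of_mem _ (mem_univ i)) (PSC.stdTheta_strictMono m)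

lemma thetaCoeff_stdTheta (m : ℕ) :
    thetaCoeff (PSC.stdTheta m) (univ.image (PSC.stdTheta m)) = 1 := by
  have h := thetaCoeff_orderEmbOfFin_comp (card_image_stdTheta m) 1
  simp only [Equiv.Perm.coe_one, id, ← stdTheta_eq_orderEmbOfFin, Equiv.Perm.sign_one,
    Units.val_one, Int.cast_one] at h
  exact h

/-- The coefficient of the monomials of type `K`. -/
def typeCoeff (K : PSC n m) : sNCSym →ₗ[ℚ] ℚ where
  toFun f := f.1 (univ.image (PSC.stdTheta m), List.ofFn K.stdWord)
  map_add' _ _ := rfl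
  map_smul' _ _ := rfl

/-- Two monomials of the same type with distinct θ-indices differ by a permutation of the indices,
so invariance carries the standard coefficient to any other, up to the sorting sign. -/
lemma typeCoeff_eq {K : PSC n m} {a : Fin m → ℕ+} {b : Fin n → ℕ+} (h : K.InM a b)
    (ha : Function.Injective a) (f : sNCSym) :
    typeCoeff K f = thetaCoeff a (univ.image a) * f.1 (univ.image a, List.ofFn b) := by
  obtain ⟨N, s, hN, hs⟩ := exists_perm_extending
    (g := Sum.elim (PSC.stdTheta m) K.stdWord) (g' := Sum.elim a b) (by
      have h' := K.stdWord_inM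
      rintro (i | i) (j | j)
      · simp [(PSC.stdTheta_strictMono m).injective.eq_iff, ha.eq_iff]
      · simp [h.1, h'.1]
      · simp only [Sum.elim_inl, Sum.elim_inr]
        rw [eq_comm, h'.1, eq_comm, h.1]
      · simp [h.2, h'.2])
  have h1 := sNCSym_apply_perm f.2 hN (PSC.stdTheta m) K.stdWord
  have h2 : (fun i => s (PSC.stdTheta m i)) = a := funext fun i => hs (Sum.inl i)
  have h3 : (fun j => s (K.stdWord j)) = b := funext fun j => hs (Sum.inr j)
  rw [h2, h3, thetaCoeff_stdTheta, one_mul] at h1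
  exact h1.symm

/-- Each of the `m!` orderings of the θ's has its own type and contributes the same amount, which
explains the normalising factor. -/
lemma apply_eq_sum_typeCoeff (f : sNCSym) {A : Finset ℕ+} {w : List ℕ+} (hA : A.card = m)
    (hw : w.length = n) :
    f.1 (A, w) = (1 / (m.factorial : ℚ)) *
      ∑ K : PSC n m, typeCoeff K f * (mFun K).1 (A, w) := by
  obtain ⟨b, rfl⟩ := exists_eq_ofFn hw
  let a : Equiv.Perm (Fin m) → Fin m → ℕ+ := fun σ i => A.orderEmbOfFin hA (σ i)
  have ha : ∀ σ, Function.Injective (a σ) :=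
    fun σ => (A.orderEmbOfFin hA).injective.comp σ.injective
  have haA : ∀ σ, univ.image (a σ) = A := image_orderEmbOfFin_comp hA
  by_cases hnull : NullSymmetric (a 1) b
  · have hz : ∀ g : sNCSym, g.1 (A, List.ofFn b) = 0 := fun g => by
      have := sNCSym_apply_eq_zero g.2 (ha 1) hnull
      rwa [haA] at this
    simp [hz]
  have hm := le_succ_of_not_nullSymmetric (ha 1) hnull
  have h1 : ∀ K : PSC n m, (mFun K).1 (A, List.ofFn b) = ∑ σ : Equiv.Perm (Fin m),
      ((Equiv.Perm.sign σ : ℤ) : ℚ) * if K.InM (a σ) b then 1 else 0 :=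
    fun K => formalSum_apply (fun a b => if K.InM a b then 1 else 0) hA b
  -- Only the type of the ordering `σ` survives, and its sign cancels against the one in
  -- `typeCoeff_eq`.
  have h2 : ∀ σ : Equiv.Perm (Fin m), ∑ K : PSC n m, typeCoeff K f *
      (((Equiv.Perm.sign σ : ℤ) : ℚ) * if K.InM (a σ) b then 1 else 0) =
      f.1 (A, List.ofFn b) := by
    intro σ
    obtain ⟨N, hN⟩ := PSC.exists_inM hm (ha σ) b
    rw [sum_eq_single N]
    · rw [if_pos hN, mul_one, typeCoeff_eq hN (ha σ), haA, thetaCoeff_orderEmbOfFin_comp]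
      rcases Int.units_eq_one_or (Equiv.Perm.sign σ) with h | h <;> simp [h]
    · intro K _ hK
      rw [if_neg fun h => hK (h.unique hN), mul_zero, mul_zero]
    · exact fun h => (h (mem_univ _)).elim
  have h3 : ∑ K : PSC n m, typeCoeff K f * (mFun K).1 (A, List.ofFn b) =
      ∑ σ : Equiv.Perm (Fin m), f.1 (A, List.ofFn b) := by
    simp only [h1, mul_sum]
    rw [sum_comm, sum_congr rfl fun σ _ => h2 σ]
  rw [h3, sum_const, card_univ, Fintype.card_perm,
    Fintype.card_fin, nsmul_eq_mul, one_div, inv_mul_cancel_left₀]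
  exact Nat.cast_ne_zero.2 m.factorial_ne_zero

lemma mFun_apply_eq_zero (K : PSC n m) {u : SMonomial}
    (hu : ¬ (u.1.card = m ∧ u.2.length = n)) : (mFun K).1 u = 0 :=
  formalSum_eq_zero (fun a b => if K.InM a b then 1 else 0) hu

lemma exists_eq_sum_mFun (f : sNCSym) : ∃ d : ℕ, f = ∑ n ∈ range d, ∑ m ∈ range d,
    (1 / (m.factorial : ℚ)) • ∑ K : PSC n m, typeCoeff K f • mFun K := by
  obtain ⟨d, hd⟩ := f.2.1
  refine ⟨d + 1, Subtype.ext (funext fun ⟨A, w⟩ => ?_)⟩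
  have h1 : ∀ n m, ((1 / (m.factorial : ℚ)) • ∑ K : PSC n m, typeCoeff K f • mFun K).1 (A, w) =
      if m = A.card then if n = w.length then f.1 (A, w) else 0 else 0 := by
    intro n m
    have h2 : ((1 / (m.factorial : ℚ)) • ∑ K : PSC n m, typeCoeff K f • mFun K).1 (A, w) =
        (1 / (m.factorial : ℚ)) * ∑ K : PSC n m, typeCoeff K f * (mFun K).1 (A, w) := by
      simp
    rw [h2, ← ite_and]
    split_ifs with h
    · exact (apply_eq_sum_typeCoeff f h.1.symm h.2.symm).symm
    · rw [sum_eq_zero, mul_zero]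
      intro K _
      rw [mFun_apply_eq_zero K fun h' => h ⟨h'.1.symm, h'.2.symm⟩, mul_zero]
  have h2 : (∑ n ∈ range (d + 1), ∑ m ∈ range (d + 1),
      (1 / (m.factorial : ℚ)) • ∑ K : PSC n m, typeCoeff K f • mFun K : sNCSym).1 (A, w) =
      ∑ n ∈ range (d + 1), ∑ m ∈ range (d + 1),
        ((1 / (m.factorial : ℚ)) • ∑ K : PSC n m, typeCoeff K f • mFun K).1 (A, w) := by
    simp only [AddSubmonoidClass.coe_finsetSum, Finset.sum_apply]
  rw [h2]
  simp only [h1]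
  by_cases hu : f.1 (A, w) = 0
  · simp [hu]
  · have := hd _ hu
    simp only at this
    rw [sum_comm]
    simp only [sum_ite_irrel, sum_const_zero, sum_ite_eq', mem_range]
    rw [if_pos (by omega), if_pos (by omega)]

lemma linearMap_ext_pFun {V : Type*} [AddCommGroup V] [Module ℚ V] {φ ψ : sNCSym →ₗ[ℚ] V}
    (h : ∀ (n m : ℕ) (K : PSC n m), φ (pFun K) = ψ (pFun K)) : φ = ψ := by
  have h1 : ∀ (n m : ℕ) (K : PSC n m), φ (mFun K) = ψ (mFun K) := by
    intro n m K
    rw [mFun_eq_sum_pFun]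
    simp [h]
  ext f
  obtain ⟨d, hf⟩ := exists_eq_sum_mFun f
  rw [hf]
  simp [h1]

end Expansion

/-! ### The involution -/

section Omega

variable {n m : ℕ}

/-- The image of `m_K` under the involution `ω`. -/
def qFun (K : PSC n m) : sNCSym := ∑ L ∈ K.coarser, PSC.mu K L • L.sign • pFun L

lemma sum_qFun (K : PSC n m) : ∑ L ∈ K.coarser, qFun L = K.sign • pFun K :=
  PSC.sum_coarser_sum_mu_smul (fun L => L.sign • pFun L) K

/-- Möbius inversion determines `qFun` from its sums over upper sets; the signed permuted family has
the same sums because `pFun` alternates and `sign` is invariant. -/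
lemma qFun_act (K : PSC n m) (σ : Equiv.Perm (Fin m)) :
    qFun (K.act σ) = ((Equiv.Perm.sign σ : ℤ) : ℚ) • qFun K := by
  have hs : ((Equiv.Perm.sign σ : ℤ) : ℚ) * ((Equiv.Perm.sign σ : ℤ) : ℚ) = 1 := by
    rcases Int.units_eq_one_or (Equiv.Perm.sign σ) with h | h <;> simp [h]
  have h := PSC.eq_sum_coarser_mu_smul (g := fun L : PSC n m => L.sign • pFun L)
    (f := fun L => ((Equiv.Perm.sign σ : ℤ) : ℚ) • qFun (L.act σ)) (fun L => by
      have h1 : ∑ N ∈ L.coarser, qFun (N.act σ) = ∑ N ∈ (L.act σ).coarser, qFun N :=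
        sum_equiv (PSC.actEquiv σ)
          (fun N => by
            rw [PSC.mem_coarser, PSC.mem_coarser]
            exact (PSC.act_le_act σ).symm) fun N _ => rfl
      rw [← smul_sum, h1, sum_qFun, PSC.sign_act, pFun_act, smul_comm L.sign, smul_smul, hs,
        one_smul]) K
  rw [qFun.eq_1 K, ← h, smul_smul, hs, one_smul]

lemma qFun_apply_eq_zero (K : PSC n m) {u : SMonomial}
    (hu : ¬ (u.1.card = m ∧ u.2.length = n)) : (qFun K).1 u = 0 := by
  have hp : ∀ L : PSC n m, (pFun L).1 u = 0 := fun L =>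
    formalSum_eq_zero (fun a b => if L.InP a b then 1 else 0) hu
  simp [qFun, hp]

lemma typeCoeff_mFun (K L : PSC n m) : typeCoeff L (mFun K) =
    ∑ σ : Equiv.Perm (Fin m), ((Equiv.Perm.sign σ : ℤ) : ℚ) * if K = L.act σ then 1 else 0 := by
  refine (formalSum_apply (fun a b => if K.InM a b then 1 else 0) (card_image_stdTheta m)
    L.stdWord).trans
    (sum_congr rfl fun σ _ => ?_)
  rw [← stdTheta_eq_orderEmbOfFin]
  have h1 := (L.act_inM σ (PSC.stdTheta m) L.stdWord).2 L.stdWord_inM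
  exact congrArg _ (if_congr ⟨fun h => h.unique h1, fun h => h ▸ h1⟩ rfl rfl)

/-- The coefficients of `ω f`. -/
def omegaFun (f : sNCSym) : SMonomial → ℚ := fun u =>
  (1 / (u.1.card.factorial : ℚ)) *
    ∑ K : PSC u.2.length u.1.card, typeCoeff K f * (qFun K).1 u

lemma omegaFun_apply (f : sNCSym) {u : SMonomial} (hm : u.1.card = m) (hn : u.2.length = n) :
    omegaFun f u = (1 / (m.factorial : ℚ)) *
      ∑ K : PSC n m, typeCoeff K f * (qFun K).1 u := by
  subst hm hn
  rfl

/-- A nonzero coefficient in some bidegree forces a nonzero `typeCoeff K f` in the same bidegree,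
which bounds the degree. Index permutations preserve the bidegree, so invariance is inherited from
each `qFun K`. -/
lemma omegaFun_mem (f : sNCSym) : omegaFun f ∈ sNCSym := by
  refine ⟨?_, fun N s hs => ?_⟩
  · obtain ⟨d, hd⟩ := f.2.1
    refine ⟨d, fun u hu => ?_⟩
    obtain ⟨K, -, hK⟩ := exists_ne_zero_of_sum_ne_zero (right_ne_zero_of_mul hu)
    have := hd _ (left_ne_zero_of_mul hK)
    simpa [card_image_stdTheta] using this
  · ext u
    change thetaCoeff _ u.1 * omegaFun f (u.1.image s.symm, u.2.map s.symm) = _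
    rw [omegaFun_apply f (card_image_of_injective u.1 s.symm.injective)
      (List.length_map (as := u.2) s.symm), omegaFun, mul_left_comm, mul_sum]
    congr 1
    refine sum_congr rfl fun K _ => ?_
    rw [mul_left_comm]
    congr 1
    exact congrFun ((qFun K).2.2 N s hs) u

/-- The involution `ω`. -/
def omega : sNCSym →ₗ[ℚ] sNCSym where
  toFun f := ⟨omegaFun f, omegaFun_mem f⟩
  map_add' f g := by
    ext u
    simp [omegaFun, add_mul, sum_add_distrib, mul_add]
  map_smul' c f := by
    ext u
    simp [omegaFun, mul_assoc, mul_left_comm, ← mul_sum]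

/-- The types seen by `mFun K` are the block permutations of `K`. Since `qFun` alternates, each of
the `m!` permutations contributes `qFun K`, cancelling the normalisation. -/
lemma omega_mFun (K : PSC n m) : omega (mFun K) = qFun K := by
  apply Subtype.ext
  funext u
  change omegaFun (mFun K) u = _
  by_cases hu : u.1.card = m ∧ u.2.length = n
  · rw [omegaFun_apply _ hu.1 hu.2]
    simp only [typeCoeff_mFun, sum_mul]
    rw [sum_comm]
    have h : ∀ σ : Equiv.Perm (Fin m), ∑ L : PSC n m, ((Equiv.Perm.sign σ : ℤ) : ℚ) *
        (if K = L.act σ then 1 else 0) * (qFun L).1 u = (qFun K).1 u := by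
      intro σ
      rw [sum_eq_single (K.act σ⁻¹)]
      · rw [PSC.act_act, inv_mul_cancel, PSC.act_one, if_pos rfl, mul_one, qFun_act]
        rcases Int.units_eq_one_or (Equiv.Perm.sign σ) with h | h <;> simp [h]
      · intro L _ hL
        rw [if_neg, mul_zero, zero_mul]
        rintro rfl
        exact hL (by rw [PSC.act_act, mul_inv_cancel, PSC.act_one])
      · exact fun h => (h (mem_univ _)).elim
    rw [sum_congr rfl fun σ _ => h σ, sum_const, card_univ, Fintype.card_perm,
      Fintype.card_fin, nsmul_eq_mul, one_div, inv_mul_cancel_left₀]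
    exact Nat.cast_ne_zero.2 m.factorial_ne_zero
  · rw [qFun_apply_eq_zero K hu, omegaFun, sum_eq_zero, mul_zero]
    intro L _
    have : typeCoeff L (mFun K) = 0 := by
      refine mFun_apply_eq_zero K fun h => hu ?_
      simpa [card_image_stdTheta] using h
    rw [this, zero_mul]

lemma omega_pFun (K : PSC n m) : omega (pFun K) = K.sign • pFun K := by
  rw [pFun_eq_sum_mFun, map_sum]
  simp only [omega_mFun]
  rw [sum_qFun, ← pFun_eq_sum_mFun]

lemma omega_eFun (K : PSC n m) : omega (eFun K) = hFun K := by
  rw [eFun_eq_sum_pFun, hFun_eq_sum_pFun, map_sum]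
  refine sum_congr rfl fun L _ => ?_
  rw [map_smul, omega_pFun, smul_smul, PSC.abs_muZero_eq_sign_mul, mul_comm]

lemma omega_comp_omega : omega ∘ₗ omega = LinearMap.id := by
  refine linearMap_ext_pFun fun n m K => ?_
  rw [LinearMap.comp_apply, omega_pFun, map_smul, omega_pFun, smul_smul, PSC.sign_mul_self,
    one_smul, LinearMap.id_apply]

/-- Alternation of `eFun` extends the agreement from set superpartitions to every `eFun L`; Möbius
inversion then gives every `pFun K`, and these span. -/
lemma eq_omega {ω : sNCSym →ₗ[ℚ] sNCSym}
    (h : ∀ (n m : ℕ) (I : SetSuperpartition n m), ω (eFun I.1) = hFun I.1) : ω = omega := by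
  refine linearMap_ext_pFun fun n m K => ?_
  have h1 : ∀ L : PSC n m, ω (eFun L) = omega (eFun L) := by
    refine eq_of_eq_on_setSuperpartition (fun L σ => ?_) (fun L σ => ?_) fun I => ?_
    · rw [eFun_act, map_smul]
    · rw [eFun_act, map_smul]
    · rw [h, omega_eFun]
  rw [pFun_eq_sum_eFun]
  simp [h1]

end Omega

end SuperNC

end

open SuperNC in
theorem mainTheorem4 :
    (∀ (n m : ℕ) (I : SetSuperpartition n m),
      eFun I.1 = ∑ K ∈ I.1.finer, K.muZero • pFun K ∧
      pFun I.1 = (1 / I.1.muZero) • ∑ K ∈ I.1.finer, PSC.mu K I.1 • eFun K ∧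
      hFun I.1 = ∑ K ∈ I.1.finer, |K.muZero| • pFun K ∧
      pFun I.1 = (1 / |I.1.muZero|) • ∑ K ∈ I.1.finer, PSC.mu K I.1 • hFun K ∧
      eFun I.1 = ∑ K ∈ I.1.finer,
        K.sign • ∑ L ∈ K.finer, PSC.mu L K • hFun L ∧
      hFun I.1 = ∑ K ∈ I.1.finer,
        K.sign • ∑ L ∈ K.finer, PSC.mu L K • eFun L) ∧
    ∃ ω : sNCSym →ₗ[ℚ] sNCSym,
      (∀ (n m : ℕ) (I : SetSuperpartition n m), ω (eFun I.1) = hFun I.1) ∧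
      (∀ ω' : sNCSym →ₗ[ℚ] sNCSym,
        (∀ (n m : ℕ) (I : SetSuperpartition n m), ω' (eFun I.1) = hFun I.1) → ω' = ω) ∧
      ω ∘ₗ ω = LinearMap.id ∧
      ∀ (n m : ℕ) (I : SetSuperpartition n m), ω (pFun I.1) = I.1.sign • pFun I.1 :=
  ⟨fun _ _ I => ⟨eFun_eq_sum_pFun I.1, pFun_eq_sum_eFun I.1, hFun_eq_sum_pFun I.1,
    pFun_eq_sum_hFun I.1, eFun_eq_sum_hFun I.1, hFun_eq_sum_eFun I.1⟩,
    omega, fun _ _ I => omega_eFun I.1, fun _ h => eq_omega h, omega_comp_omega,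
    fun _ _ I => omega_pFun I.1⟩
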